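/- Let $n\ge 2$ and let $\overline B_n$ be the closed unit ball of $\mathbb R^n$. A particle moves in $\overline B_n$ in straight lines with unit speed, and is reflected specularly on the boundary sphere: when it reaches $x\in\mathbb S_{n-1}$ with velocity $v$, its velocity becomes $v-2\langle x,v\rangle x$. Let $T^1\overline B_n$ be the phase space, that is, the quotient of $\overline B_n\times\mathbb S_{n-1}$ by the identification $(x,v)\sim(x,v-2\langle x,v\rangle x)$ for $\|x\|=1$. Let $(g_t)_{t\in\mathbb R}$ be the billiard flow on $T^1\overline B_n$ (on the negligible set of grazing states, $\|x\|=1$ and $\langle x,v\rangle=0$, it is extended by continuity: $g_t(x,v)=(\cos t\,x+\sin t\,v,\,-\sin t\,x+\cos t\,v)$). Let $\mu_n$ be the Liouville measure, normalised to be a probability measure: the image in $T^1\overline B_n$ of the normalised product of the Lebesgue measure of $\overline B_n$ and of the surface measure of $\mathbb S_{n-1}$. Then $(g_t)_{t\in\mathbb R}$ is a flow which preserves $\mu_n$, and the system $(T^1\overline B_n,\mu_n,(g_t)_{t\in\mathbb R})$ exhibits Keplerian shear: for every $f\in\mathbb L^2(T^1\overline B_n,\mu_n)$ (complex-valued), $$f\circ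 g_t \longrightarrow \mathbb E_{\mu_n}(f\mid\mathcal I)\qquad (t\to+\infty)$$ for the weak topology of $\mathbb L^2(T^1\overline B_n,\mu_n)$, where $\mathcal I$ is the $\sigma$-algebra of the measurable sets $A$ such that $g_t^{-1}(A)=A$ for all $t\in\mathbb R$. -/

import Mathlib

open MeasureTheory Filter Topology Metric
open scoped RealInnerProductSpace ComplexConjugate

/-! ## Keplerian shear -/

namespace KeplerianShear

section General

variable {Ω : Type*} [MeasurableSpace Ω]

/-- `(Ω, μ, (g t))` is a flow which preserves the probability measure `μ`. -/
structure IsProbabilityPreservingFlow (μ : Measure Ω) (g : ℝ → Ω → Ω) : Prop where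
  isProbabilityMeasure : IsProbabilityMeasure μ
  map_zero : g 0 = id
  map_add : ∀ s t : ℝ, g (s + t) = g s ∘ g t
  measurePreserving : ∀ t : ℝ, MeasurePreserving (g t) μ μ

/-- The invariant σ-algebra of a flow: the measurable sets `A` such that `(g t)⁻¹ A = A` for
all times `t`. -/
@[reducible] def invariantSigmaAlgebra (g : ℝ → Ω → Ω) : MeasurableSpace Ω :=
  ⨅ t : ℝ, MeasurableSpace.invariants (g t)

/-- The system `(Ω, μ, (g t))` preserves the probability measure `μ`, and for every `f ∈ L²(μ)`
the functions `f ∘ g t` converge, for the weak topology of `L²(μ)` and as `t → +∞`, to the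
conditional expectation of `f` with respect to the invariant σ-algebra. -/
def ExhibitsKeplerianShear (μ : Measure Ω) (g : ℝ → Ω → Ω) : Prop :=
  IsProbabilityPreservingFlow μ g ∧
    ∀ f : Ω → ℂ, MemLp f 2 μ → ∀ φ : Ω → ℂ, MemLp φ 2 μ →
      Tendsto (fun t : ℝ => ∫ ω, conj (φ ω) * f (g t ω) ∂μ) atTop
        (𝓝 (∫ ω, conj (φ ω) * (μ[f | invariantSigmaAlgebra g]) ω ∂μ))

end General

/-! ## The billiard in the unit ball -/

/-- `ℝⁿ` with its Euclidean structure. -/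
abbrev E (n : ℕ) : Type := EuclideanSpace ℝ (Fin n)

/-- Pairs (position in the closed unit ball, unit velocity). -/
abbrev PosVel (n : ℕ) : Type := closedBall (0 : E n) 1 × sphere (0 : E n) 1

/-- Specular reflection of the velocity `v` in the hyperplane orthogonal to the unit vector `x`,
which is the tangent hyperplane of the unit sphere at `x`. -/
noncomputable def reflect {n : ℕ} (x v : E n) : E n := v - (2 * ⟪x, v⟫) • x

section Facts

variable {n : ℕ} {x v : E n}

theorem inner_reflect (hx : ‖x‖ = 1) : ⟪x, reflect x v⟫ = -⟪x, v⟫ := by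
  simp only [reflect, inner_sub_right, inner_smul_right, real_inner_self_eq_norm_sq, hx]
  ring

theorem norm_reflect (hx : ‖x‖ = 1) : ‖reflect x v‖ = ‖v‖ := by
  have h : ‖reflect x v‖ ^ 2 = ‖v‖ ^ 2 := by
    rw [reflect, norm_sub_sq_real, norm_smul, inner_smul_right, hx, real_inner_comm,
      Real.norm_eq_abs, mul_one, sq_abs]
    ring
  exact (sq_eq_sq₀ (norm_nonneg _) (norm_nonneg _)).1 h

theorem reflect_reflect (hx : ‖x‖ = 1) : reflect x (reflect x v) = v := by
  rw [reflect, inner_reflect hx, reflect]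
  module

theorem norm_add_smul_sq (hv : ‖v‖ = 1) (s : ℝ) :
    ‖x + s • v‖ ^ 2 = ‖x‖ ^ 2 + 2 * s * ⟪x, v⟫ + s ^ 2 := by
  rw [norm_add_sq_real, norm_smul, inner_smul_right, hv, Real.norm_eq_abs, mul_one, sq_abs]
  ring

theorem inner_add_smul (hv : ‖v‖ = 1) (s : ℝ) : ⟪x + s • v, v⟫ = ⟪x, v⟫ + s := by
  rw [inner_add_left, real_inner_smul_left, real_inner_self_eq_norm_sq, hv]
  ring

theorem norm_eq_one_of_sq {y : E n} (h : ‖y‖ ^ 2 = 1) : ‖y‖ = 1 :=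
  (pow_eq_one_iff_of_nonneg (norm_nonneg y) two_ne_zero).1 h

end Facts

/-- The effect of a collision: nothing in the interior of the ball, specular reflection of the
velocity on the boundary. -/
noncomputable def collide {n : ℕ} (p : PosVel n) : PosVel n :=
  open Classical in
  if h : ‖(p.1 : E n)‖ = 1 then
    (p.1, ⟨reflect (p.1 : E n) p.2, by
      rw [mem_sphere_zero_iff_norm, norm_reflect h]; exact norm_eq_of_mem_sphere p.2⟩)
  else p

theorem collide_collide {n : ℕ} (p : PosVel n) : collide (collide p) = p := by
  by_cases h : ‖(p.1 : E n)‖ = 1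
  · refine Prod.ext ?_ (Subtype.ext ?_) <;> simp [collide, h, reflect_reflect]
  · simp [collide, h]

/-- Two pairs are identified if they differ by a collision: the velocities just before and just
after a collision define the same state. -/
def collisionSetoid (n : ℕ) : Setoid (PosVel n) where
  r p q := q = p ∨ q = collide p
  iseqv :=
    { refl := fun _ => Or.inl rfl
      symm := by
        rintro p q (rfl | rfl)
        · exact Or.inl rfl
        · exact Or.inr (collide_collide p).symm
      trans := by
        rintro p q r (rfl | rfl) (rfl | rfl)
        · exact Or.inl rfl
        · exact Or.inr rfl
        · exact Or.inr rfl
        · exact Or.inl (collide_collide p) }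

/-- The phase space `T¹ B̄ₙ` of the billiard in the closed unit ball. It carries the quotient
σ-algebra. -/
abbrev PhaseSpace (n : ℕ) : Type := Quotient (collisionSetoid n)

/-- The normalised Liouville measure: the image in the phase space of the product of the Lebesgue
measure of the ball and of the surface measure of the sphere, divided by its total mass. -/
noncomputable def liouville (n : ℕ) : Measure (PhaseSpace n) :=
  let ν : Measure (PosVel n) :=
    (Measure.comap Subtype.val (volume : Measure (E n))).prod (volume : Measure (E n)).toSphere
  (ν Set.univ)⁻¹ • ν.map (Quotient.mk (collisionSetoid n))

/-- Pairs (point of the unit sphere, unit vector pointing strictly inwards): the non-grazing states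
just after a collision. -/
abbrev Inward (n : ℕ) : Type :=
  {a : E n × E n // ‖a.1‖ = 1 ∧ ‖a.2‖ = 1 ∧ ⟪a.1, a.2⟫ < 0}

/-- The length of the chord that starts at `a.1` with direction `a.2`, which is the time until the
next collision. -/
noncomputable def chord {n : ℕ} (a : Inward n) : ℝ := -2 * ⟪a.1.1, a.1.2⟫

theorem chord_pos {n : ℕ} (a : Inward n) : 0 < chord a := by
  have := a.2.2.2
  unfold chord
  linarith

theorem norm_chord_end {n : ℕ} (a : Inward n) : ‖a.1.1 + chord a • a.1.2‖ = 1 := by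
  apply norm_eq_one_of_sq
  rw [norm_add_smul_sq a.2.2.1, a.2.1, chord]
  ring

theorem inner_chord_end {n : ℕ} (a : Inward n) :
    ⟪a.1.1 + chord a • a.1.2, a.1.2⟫ = -⟪a.1.1, a.1.2⟫ := by
  rw [inner_add_smul a.2.2.1, chord]
  ring

/-- Follow the chord to its other end point, and reflect there. -/
noncomputable def nextCollision {n : ℕ} (a : Inward n) : Inward n :=
  ⟨(a.1.1 + chord a • a.1.2, reflect (a.1.1 + chord a • a.1.2) a.1.2),
    norm_chord_end a, (norm_reflect (norm_chord_end a)).trans a.2.2.1, by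
      rw [inner_reflect (norm_chord_end a), inner_chord_end, neg_neg]
      exact a.2.2.2⟩

/-- Undo the reflection, and follow the chord that led to it backwards. -/
noncomputable def prevCollision {n : ℕ} (a : Inward n) : Inward n :=
  ⟨(a.1.1 - chord a • reflect a.1.1 a.1.2, reflect a.1.1 a.1.2), by
    have hv : ‖reflect a.1.1 a.1.2‖ = 1 := (norm_reflect a.2.1).trans a.2.2.1
    rw [sub_eq_add_neg, ← neg_smul]
    refine ⟨norm_eq_one_of_sq ?_, hv, ?_⟩
    · rw [norm_add_smul_sq hv, a.2.1, inner_reflect a.2.1, chord]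
      ring
    · rw [inner_add_smul hv, inner_reflect a.2.1, chord]
      linarith [a.2.2.2]⟩

theorem chord_nextCollision {n : ℕ} (a : Inward n) : chord (nextCollision a) = chord a := by
  rw [chord, nextCollision, inner_reflect (norm_chord_end a), inner_chord_end, neg_neg, chord]

theorem chord_prevCollision {n : ℕ} (a : Inward n) : chord (prevCollision a) = chord a := by
  have hv : ‖reflect a.1.1 a.1.2‖ = 1 := (norm_reflect a.2.1).trans a.2.2.1
  change -2 * ⟪a.1.1 - chord a • reflect a.1.1 a.1.2, reflect a.1.1 a.1.2⟫ = chord a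
  rw [sub_eq_add_neg, ← neg_smul, inner_add_smul hv, inner_reflect a.2.1, chord]
  ring

/-- The billiard map: from one collision to the next. -/
noncomputable def billiardMap (n : ℕ) : Equiv.Perm (Inward n) where
  toFun := nextCollision
  invFun := prevCollision
  left_inv a := by
    apply Subtype.ext
    have h : reflect (nextCollision a).1.1 (nextCollision a).1.2 = a.1.2 :=
      reflect_reflect (norm_chord_end a)
    refine Prod.ext ?_ h
    change (nextCollision a).1.1 - chord (nextCollision a) •
      reflect (nextCollision a).1.1 (nextCollision a).1.2 = a.1.1
    rw [h, chord_nextCollision]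
    simp [nextCollision]
  right_inv a := by
    have h : (prevCollision a).1.1 + chord (prevCollision a) • (prevCollision a).1.2 = a.1.1 := by
      rw [chord_prevCollision]
      simp [prevCollision]
    apply Subtype.ext
    refine Prod.ext h ?_
    change reflect ((prevCollision a).1.1 + chord (prevCollision a) • (prevCollision a).1.2)
      (prevCollision a).1.2 = a.1.2
    rw [h]
    exact reflect_reflect a.2.1

/-- In a ball, all the chords of a trajectory have the same length. -/
theorem chord_billiardMap_zpow {n : ℕ} (k : ℤ) (a : Inward n) :
    chord ((billiardMap n ^ k) a) = chord a := by
  induction k using Int.induction_on with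
  | zero => simp
  | succ k ih =>
    rw [add_comm, zpow_add, zpow_one, Equiv.Perm.mul_apply]
    exact (chord_nextCollision _).trans ih
  | pred k ih =>
    rw [sub_eq_neg_add, zpow_add, zpow_neg_one, Equiv.Perm.mul_apply]
    exact (chord_prevCollision _).trans ih

/-- The position and velocity at time `u` of a particle which is in the state `a` just after a
collision at time `0`. As all the chords have the same length `chord a`, it has gone through
`⌊u / chord a⌋` further collisions, and has been moving in a straight line since then. -/
noncomputable def afterCollision {n : ℕ} (a : Inward n) (u : ℝ) : PosVel n :=
  let k : ℤ := ⌊u / chord a⌋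
  let c : Inward n := (billiardMap n ^ k) a
  (⟨c.1.1 + (u - k * chord a) • c.1.2, by
      have h0 : 0 ≤ u - k * chord a :=
        sub_nonneg.2 ((le_div_iff₀ (chord_pos a)).1 (Int.floor_le _))
      have h1 : u - k * chord a ≤ chord a := by
        have := (div_lt_iff₀ (chord_pos a)).1 (Int.lt_floor_add_one (u / chord a))
        linarith
      have hc : -2 * ⟪c.1.1, c.1.2⟫ = chord a := chord_billiardMap_zpow k a
      rw [mem_closedBall_zero_iff, ← sq_le_one_iff₀ (norm_nonneg _), norm_add_smul_sq c.2.2.1,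
        c.2.1]
      nlinarith⟩,
    ⟨c.1.2, mem_sphere_zero_iff_norm.2 c.2.2.1⟩)

theorem afterCollision_nextCollision {n : ℕ} (a : Inward n) (u : ℝ) :
    afterCollision (nextCollision a) u = afterCollision a (chord a + u) := by
  have hk : ⌊(chord a + u) / chord a⌋ = ⌊u / chord a⌋ + 1 := by
    rw [add_div, div_self (chord_pos a).ne', add_comm, Int.floor_add_one]
  have hB : (billiardMap n ^ (⌊u / chord a⌋ + 1)) a
      = (billiardMap n ^ ⌊u / chord a⌋) (nextCollision a) := by
    rw [zpow_add, zpow_one, Equiv.Perm.mul_apply]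
    rfl
  have hr : chord a + u - ((⌊u / chord a⌋ + 1 : ℤ) : ℝ) * chord a
      = u - ⌊u / chord a⌋ * chord a := by
    push_cast
    ring
  refine Prod.ext (Subtype.ext ?_) (Subtype.ext ?_)
  · simp only [afterCollision, chord_nextCollision, hk, hB, hr]
  · simp only [afterCollision, chord_nextCollision, hk, hB]

/-- Half the length of the chord `{x + s v : s ∈ ℝ} ∩ B̄ₙ` through the position `x` in the direction
of the velocity `v`. It is zero exactly when the state is grazing, that is, when `x` is on the
boundary and `v` is tangent to it. -/
noncomputable def halfChord {n : ℕ} (p : PosVel n) : ℝ :=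
  √(⟪(p.1 : E n), (p.2 : E n)⟫ ^ 2 + (1 - ‖(p.1 : E n)‖ ^ 2))

theorem sq_halfChord {n : ℕ} (p : PosVel n) :
    halfChord p ^ 2 = ⟪(p.1 : E n), (p.2 : E n)⟫ ^ 2 + (1 - ‖(p.1 : E n)‖ ^ 2) := by
  apply Real.sq_sqrt
  have h := mem_closedBall_zero_iff.1 p.1.2
  have := (sq_le_one_iff₀ (norm_nonneg (p.1 : E n))).2 h
  nlinarith [sq_nonneg ⟪(p.1 : E n), (p.2 : E n)⟫]

theorem grazing_of_halfChord_eq_zero {n : ℕ} {p : PosVel n} (h : halfChord p = 0) :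
    ‖(p.1 : E n)‖ = 1 ∧ ⟪(p.1 : E n), (p.2 : E n)⟫ = 0 := by
  have hs := sq_halfChord p
  rw [h] at hs
  have := (sq_le_one_iff₀ (norm_nonneg (p.1 : E n))).2 (mem_closedBall_zero_iff.1 p.1.2)
  have hb := sq_nonneg ⟪(p.1 : E n), (p.2 : E n)⟫
  exact ⟨norm_eq_one_of_sq (by nlinarith), pow_eq_zero_iff two_ne_zero |>.1 (by nlinarith)⟩

/-- The time elapsed since the last collision. -/
noncomputable def age {n : ℕ} (p : PosVel n) : ℝ :=
  ⟪(p.1 : E n), (p.2 : E n)⟫ + halfChord p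

/-- The state just after the last collision of a non-grazing state `(x, v)`: the point at which
the half-line `{x - s v : s ≥ 0}` leaves the ball, together with the velocity `v`. -/
noncomputable def lastCollision {n : ℕ} (p : PosVel n) (h : halfChord p ≠ 0) : Inward n :=
  ⟨((p.1 : E n) - age p • (p.2 : E n), (p.2 : E n)), by
    have hv : ‖(p.2 : E n)‖ = 1 := norm_eq_of_mem_sphere p.2
    have hs := sq_halfChord p
    have hpos : 0 < halfChord p := lt_of_le_of_ne (Real.sqrt_nonneg _) h.symm
    rw [sub_eq_add_neg, ← neg_smul]
    refine ⟨norm_eq_one_of_sq ?_, hv, ?_⟩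
    · rw [norm_add_smul_sq hv, age]
      linarith
    · rw [inner_add_smul hv, age]
      linarith⟩

theorem norm_rotate {n : ℕ} {x v : E n} (hx : ‖x‖ = 1) (hv : ‖v‖ = 1) (hxv : ⟪x, v⟫ = 0)
    {c s : ℝ} (h : c ^ 2 + s ^ 2 = 1) : ‖c • x + s • v‖ = 1 := by
  apply norm_eq_one_of_sq
  rw [norm_add_sq_real, norm_smul, norm_smul, inner_smul_right, real_inner_smul_left, hx, hv, hxv,
    Real.norm_eq_abs, Real.norm_eq_abs, mul_one, mul_one, sq_abs, sq_abs]
  linarith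

/-- The motion of a grazing state: it glides with unit speed along the great circle of the boundary
to which its velocity is tangent. This extends the billiard flow by continuity. -/
noncomputable def glide {n : ℕ} (p : PosVel n) (h : halfChord p = 0) (t : ℝ) : PosVel n :=
  (⟨Real.cos t • (p.1 : E n) + Real.sin t • (p.2 : E n), by
      have hv : ‖(p.2 : E n)‖ = 1 := norm_eq_of_mem_sphere p.2
      obtain ⟨hx, hxv⟩ := grazing_of_halfChord_eq_zero h
      exact mem_closedBall_zero_iff.2 (norm_rotate hx hv hxv (Real.cos_sq_add_sin_sq t)).le⟩,
    ⟨-Real.sin t • (p.1 : E n) + Real.cos t • (p.2 : E n), by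
      have hv : ‖(p.2 : E n)‖ = 1 := norm_eq_of_mem_sphere p.2
      obtain ⟨hx, hxv⟩ := grazing_of_halfChord_eq_zero h
      refine mem_sphere_zero_iff_norm.2 (norm_rotate hx hv hxv ?_)
      rw [neg_sq, Real.sin_sq_add_cos_sq]⟩)

/-- The evolution during the time `t` of a particle that moves with unit speed inside the unit ball
and is reflected specularly by its boundary. -/
noncomputable def evolve {n : ℕ} (t : ℝ) (p : PosVel n) : PosVel n :=
  open Classical in
  if h : halfChord p = 0 then glide p h t
  else afterCollision (lastCollision p h) (age p + t)

theorem halfChord_collide {n : ℕ} (p : PosVel n) : halfChord (collide p) = halfChord p := by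
  by_cases h : ‖(p.1 : E n)‖ = 1
  · simp [halfChord, collide, h, inner_reflect]
  · simp [collide, h]

theorem evolve_collide {n : ℕ} (t : ℝ) (p : PosVel n) : evolve t (collide p) = evolve t p := by
  by_cases hx : ‖(p.1 : E n)‖ = 1
  swap
  · simp [collide, hx]
  -- it suffices to treat an outgoing velocity
  have key : ∀ q : PosVel n, ‖(q.1 : E n)‖ = 1 → 0 < ⟪(q.1 : E n), (q.2 : E n)⟫ →
      evolve t (collide q) = evolve t q := by
    intro q hq hb
    have hh : halfChord q = ⟪(q.1 : E n), (q.2 : E n)⟫ := by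
      rw [halfChord, hq, one_pow, sub_self, add_zero, Real.sqrt_sq hb.le]
    have h0 : halfChord q ≠ 0 := hh ▸ hb.ne'
    have h0' : halfChord (collide q) ≠ 0 := (halfChord_collide q).symm ▸ h0
    have e1 : ((collide q).1 : E n) = q.1 := by simp [collide, hq]
    have e2 : ((collide q).2 : E n) = reflect (q.1 : E n) q.2 := by simp [collide, hq]
    have hage : age (collide q) = 0 := by
      rw [age, halfChord_collide, hh, e1, e2, inner_reflect hq, neg_add_cancel]
    have hchord : chord (lastCollision q h0) = age q := by
      have hv : ‖(q.2 : E n)‖ = 1 := norm_eq_of_mem_sphere q.2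
      change -2 * ⟪(q.1 : E n) - age q • (q.2 : E n), (q.2 : E n)⟫ = age q
      rw [sub_eq_add_neg, ← neg_smul, inner_add_smul hv, age, hh]
      ring
    have hend : (lastCollision q h0).1.1 + chord (lastCollision q h0) • (lastCollision q h0).1.2
        = q.1 := by
      rw [hchord]
      simp [lastCollision]
    have hnext : lastCollision (collide q) h0' = nextCollision (lastCollision q h0) := by
      apply Subtype.ext
      refine Prod.ext ?_ ?_
      · change ((collide q).1 : E n) - age (collide q) • ((collide q).2 : E n) =
          (lastCollision q h0).1.1 + chord (lastCollision q h0) • (lastCollision q h0).1.2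
        rw [hend, hage, zero_smul, sub_zero, e1]
      · change ((collide q).2 : E n) = reflect ((lastCollision q h0).1.1 +
          chord (lastCollision q h0) • (lastCollision q h0).1.2) (q.2 : E n)
        rw [hend, e2]
    rw [evolve, evolve, dif_neg h0, dif_neg h0', hnext, afterCollision_nextCollision, hchord, hage,
      zero_add]
  rcases lt_trichotomy ⟪(p.1 : E n), (p.2 : E n)⟫ 0 with hb | hb | hb
  · have h := key (collide p) (by simp [collide, hx])
      (by simpa [collide, hx, inner_reflect] using hb)
    rw [collide_collide] at h
    exact h.symm
  · have : collide p = p := by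
      refine Prod.ext ?_ (Subtype.ext ?_) <;> simp [collide, hx, reflect, hb]
    rw [this]
  · exact key p hx hb

/-- The billiard flow in the unit ball. -/
noncomputable def billiardFlow (n : ℕ) (t : ℝ) : PhaseSpace n → PhaseSpace n :=
  Quotient.map (evolve t) (by
    rintro p q (rfl | rfl)
    · exact Or.inl rfl
    · exact Or.inl (evolve_collide t p))

end KeplerianShear

namespace KeplerianShear

/-! ## Weak convergence on a dense family -/

/-! Along a trajectory the half-chord `h` is constant, collisions occur every `2h` units of time,
and each collision turns the chord by the angle `2 arcsin h` in the plane of the position and the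
velocity. At fixed `h` the motion is therefore quasi-periodic with two basic frequencies: `π / h`
for the place on the chord (`chordPhase`) and `arcsin h / h` for the direction of the chord
(`planePhase`). Products of these phases and of their conjugates, times functions of `h`, are
multiplied by `exp (i t ω(h))` under the flow, with `ω = (k π + m arcsin h) / h`.

If `k = m = 0` such a function is invariant. Otherwise `ω` has a derivative that vanishes only on a
null set, and the law of `h` is absolutely continuous because `n ≥ 2`; so `ω(h)` has an absolutely
continuous law, and the Riemann–Lebesgue lemma makes the translates tend weakly to zero
(`tendsto_integral_exp_mul_of_map_absolutelyContinuous`, `liouville_map_frequency`). Tested against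
invariant sets, this also forces the conditional expectation to vanish.

Weak convergence extends from these eigenfunctions to all of `L²` since they span a dense subspace:
`h` and the phases determine almost every state (`eq_of_phases_eq`), hence generate the σ-algebra up
to null sets by the Lusin–Souslin theorem, and Stone–Weierstrass applies on a product of discs
(`mem_closure_span_of_generating`).

The flow preserves the measure because, in a fixed direction, it acts on the pair (half-chord, age)
as a translation modulo the chord. This settles rotation invariant integrands; averaging over the
orthogonal group reduces all others to them (`lintegral_evolve`). -/

/-- Weak convergence of a bounded family of operators passes to the closed linear span. -/
theorem tendsto_inner_of_mem_closure_span {H : Type*} [NormedAddCommGroup H]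
    [InnerProductSpace ℂ H] {ι : Type*} {l : Filter ι} (U : ι → H →L[ℂ] H) (P : H →L[ℂ] H)
    (hU : ∀ t f, ‖U t f‖ ≤ ‖f‖) (hP : ∀ f, ‖P f‖ ≤ ‖f‖) (S : Set H)
    (hS : ∀ f ∈ S, ∀ φ, Tendsto (fun t => inner ℂ φ (U t f)) l (𝓝 (inner ℂ φ (P f))))
    {f : H} (hf : f ∈ closure (Submodule.span ℂ S : Set H)) (φ : H) :
    Tendsto (fun t => inner ℂ φ (U t f)) l (𝓝 (inner ℂ φ (P f))) := by
  have hspan : ∀ f ∈ Submodule.span ℂ S,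
      Tendsto (fun t => inner ℂ φ (U t f)) l (𝓝 (inner ℂ φ (P f))) := by
    intro f hf
    induction hf using Submodule.span_induction with
    | mem x hx => exact hS x hx φ
    | zero => simpa using tendsto_const_nhds
    | add x y _ _ hx hy => simpa only [map_add, inner_add_right] using hx.add hy
    | smul a x _ hx => simpa only [map_smul, inner_smul_right] using hx.const_mul a
  rw [Metric.tendsto_nhds]
  intro ε hε
  have hpos : 0 < 3 * (‖φ‖ + 1) := by positivity
  obtain ⟨f', hf', hd⟩ := Metric.mem_closure_iff.1 hf (ε / (3 * (‖φ‖ + 1))) (by positivity)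
  have hsmall : ‖φ‖ * ‖f - f'‖ < ε / 3 := by
    rw [dist_eq_norm, lt_div_iff₀ hpos] at hd
    nlinarith [norm_nonneg φ, norm_nonneg (f - f')]
  filter_upwards [(Metric.tendsto_nhds.1 (hspan f' hf')) (ε / 3) (by positivity)] with t ht
  rw [dist_eq_norm] at ht ⊢
  have h1 : ‖inner ℂ φ (U t (f - f'))‖ ≤ ‖φ‖ * ‖f - f'‖ :=
    (norm_inner_le_norm _ _).trans (mul_le_mul_of_nonneg_left (hU t _) (norm_nonneg _))
  have h2 : ‖inner ℂ φ (P (f - f'))‖ ≤ ‖φ‖ * ‖f - f'‖ :=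
    (norm_inner_le_norm _ _).trans (mul_le_mul_of_nonneg_left (hP _) (norm_nonneg _))
  have hdec : inner ℂ φ (U t f) - inner ℂ φ (P f) = (inner ℂ φ (U t f') - inner ℂ φ (P f')) +
      inner ℂ φ (U t (f - f')) - inner ℂ φ (P (f - f')) := by
    simp only [map_sub, inner_sub_right]
    ring
  rw [hdec]
  refine (norm_sub_le _ _).trans_lt ?_
  have := norm_add_le (inner ℂ φ (U t f') - inner ℂ φ (P f')) (inner ℂ φ (U t (f - f')))
  linarith

section General

variable {Ω : Type*} [m0 : MeasurableSpace Ω] {μ : Measure Ω} {g : ℝ → Ω → Ω}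

theorem invariantSigmaAlgebra_le (g : ℝ → Ω → Ω) : invariantSigmaAlgebra g ≤ m0 :=
  (iInf_le _ 0).trans (MeasurableSpace.invariants_le _)

theorem measurableSet_invariantSigmaAlgebra {s : Set Ω} :
    MeasurableSet[invariantSigmaAlgebra g] s ↔ MeasurableSet s ∧ ∀ t, g t ⁻¹' s = s := by
  simp only [MeasurableSpace.measurableSet_iInf,
    MeasurableSpace.measurableSet_invariants]
  exact ⟨fun h => ⟨(h 0).1, fun t => (h t).2⟩, fun h t => ⟨h.1, h.2 t⟩⟩

theorem measurable_invariantSigmaAlgebra {F : Ω → ℂ} (hF : Measurable F)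
    (hinv : ∀ t ω, F (g t ω) = F ω) : Measurable[invariantSigmaAlgebra g] F := by
  intro s hs
  refine measurableSet_invariantSigmaAlgebra.2 ⟨hF hs, fun t => ?_⟩
  ext ω
  simp [hinv]

/-- A function whose translates converge weakly to zero has zero conditional expectation with
respect to the invariant σ-algebra. -/
theorem condExp_eq_zero_of_tendsto (hg : IsProbabilityPreservingFlow μ g) {F : Ω → ℂ}
    (hF : MemLp F 2 μ)
    (hmix : ∀ φ : Ω → ℂ, MemLp φ 2 μ →
      Tendsto (fun t : ℝ => ∫ ω, conj (φ ω) * F (g t ω) ∂μ) atTop (𝓝 0)) :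
    μ[F | invariantSigmaAlgebra g] =ᵐ[μ] 0 := by
  have := hg.isProbabilityMeasure
  have hint : Integrable F μ := hF.integrable one_le_two
  symm
  refine ae_eq_condExp_of_forall_setIntegral_eq (invariantSigmaAlgebra_le g) hint
    (fun s _ _ => integrableOn_zero) (fun s hs _ => ?_)
    (stronglyMeasurable_zero.aestronglyMeasurable)
  obtain ⟨hsm, hs⟩ := measurableSet_invariantSigmaAlgebra.1 hs
  -- Tested against the indicator of an invariant set `s`, the correlation does not depend on `t`,
  -- by invariance of `s` and of `μ`. Being constant with limit zero, it is zero.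
  have key : ∀ t : ℝ, ∫ ω, conj (s.indicator (fun _ => (1 : ℂ)) ω) * F (g t ω) ∂μ
      = ∫ ω in s, F ω ∂μ := by
    intro t
    have h1 : ∀ ω, conj (s.indicator (fun _ => (1 : ℂ)) ω) * F (g t ω)
        = s.indicator F (g t ω) := by
      intro ω
      have hω : g t ω ∈ s ↔ ω ∈ s := by rw [← Set.mem_preimage, hs t]
      by_cases h : ω ∈ s <;> simp [h, hω]
    have hmp := hg.measurePreserving t
    rw [integral_congr_ae (Eventually.of_forall h1), ← integral_indicator hsm]
    have h2 : AEStronglyMeasurable (s.indicator F) (μ.map (g t)) := by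
      rw [hmp.map_eq]
      exact hint.aestronglyMeasurable.indicator hsm
    rw [← integral_map hmp.measurable.aemeasurable h2, hmp.map_eq]
  have hlim := hmix (s.indicator fun _ => (1 : ℂ)) ((memLp_const (1 : ℂ)).indicator hsm)
  simp only [key] at hlim
  rw [tendsto_nhds_unique tendsto_const_nhds hlim]
  simp

/-- It suffices to check Keplerian shear on a family which spans a dense subspace of `L²` and
consists of invariant functions and of functions whose translates converge weakly to zero. -/
theorem exhibitsKeplerianShear_of_dense (hg : IsProbabilityPreservingFlow μ g)
    (S : Set (Ω → ℂ)) (hSm : ∀ F ∈ S, Measurable F) (hS : ∀ F ∈ S, MemLp F 2 μ)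
    (hdense : ∀ f : Lp ℂ 2 μ,
      f ∈ closure (Submodule.span ℂ {u : Lp ℂ 2 μ | ∃ F ∈ S, u =ᵐ[μ] F} : Set (Lp ℂ 2 μ)))
    (hmix : ∀ F ∈ S, (∀ t ω, F (g t ω) = F ω) ∨ ∀ φ : Ω → ℂ, MemLp φ 2 μ →
      Tendsto (fun t : ℝ => ∫ ω, conj (φ ω) * F (g t ω) ∂μ) atTop (𝓝 0)) :
    ExhibitsKeplerianShear μ g := by
  refine ⟨hg, fun f hf φ hφ => ?_⟩
  have := hg.isProbabilityMeasure
  have hm := invariantSigmaAlgebra_le g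
  let U : ℝ → Lp ℂ 2 μ →L[ℂ] Lp ℂ 2 μ := fun t =>
    (Lp.compMeasurePreservingₗᵢ ℂ (g t) (hg.measurePreserving t)).toContinuousLinearMap
  let P : Lp ℂ 2 μ →L[ℂ] Lp ℂ 2 μ := (lpMeas ℂ ℂ (invariantSigmaAlgebra g) 2 μ).subtypeL ∘L
    condExpL2 ℂ ℂ hm
  have hU : ∀ t f, ‖U t f‖ ≤ ‖f‖ := fun t f => (LinearIsometry.norm_map _ f).le
  have hP : ∀ f, ‖P f‖ ≤ ‖f‖ := fun f => norm_condExpL2_le hm f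
  have hUae : ∀ (t : ℝ) (u : Lp ℂ 2 μ) (F : Ω → ℂ), u =ᵐ[μ] F →
      U t u =ᵐ[μ] fun ω => F (g t ω) := fun t u F hu =>
    (Lp.coeFn_compMeasurePreserving u (hg.measurePreserving t)).trans
      ((hg.measurePreserving t).quasiMeasurePreserving.ae_eq_comp hu)
  have hPae : ∀ (u : Lp ℂ 2 μ) (F : Ω → ℂ), u =ᵐ[μ] F →
      P u =ᵐ[μ] μ[F | invariantSigmaAlgebra g] := by
    intro u F hu
    have hF : MemLp F 2 μ := (memLp_congr_ae hu).1 (Lp.memLp u)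
    have hu' : u = hF.toLp F := Lp.ext (hu.trans hF.coeFn_toLp.symm)
    rw [hu']
    exact hF.condExpL2_ae_eq_condExp (𝕜 := ℂ) hm
  have hinner : ∀ (u v : Lp ℂ 2 μ) (F G : Ω → ℂ), u =ᵐ[μ] F → v =ᵐ[μ] G →
      inner ℂ u v = ∫ ω, conj (F ω) * G ω ∂μ := by
    intro u v F G hu hv
    rw [L2.inner_def]
    refine integral_congr_ae ?_
    filter_upwards [hu, hv] with ω h1 h2
    rw [h1, h2, RCLike.inner_apply, mul_comm]
  have key := tendsto_inner_of_mem_closure_span (l := atTop) U P hU hP _ ?_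
    (hdense (hf.toLp f)) (hφ.toLp φ)
  · simp_rw [hinner _ _ _ _ hφ.coeFn_toLp (hUae _ _ _ hf.coeFn_toLp)] at key
    rwa [hinner _ _ _ _ hφ.coeFn_toLp (hPae _ _ hf.coeFn_toLp)] at key
  · rintro u ⟨F, hFS, hu⟩ ψ
    have hψ : ψ =ᵐ[μ] ψ := ae_eq_rfl
    simp_rw [hinner _ _ _ _ hψ (hUae _ _ _ hu)]
    rw [hinner _ _ _ _ hψ (hPae _ _ hu)]
    rcases hmix F hFS with hinv | h0
    · have hc : μ[F | invariantSigmaAlgebra g] = F :=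
        condExp_of_stronglyMeasurable hm
          (measurable_invariantSigmaAlgebra (hSm F hFS) hinv).stronglyMeasurable
          ((hS F hFS).integrable one_le_two)
      simp_rw [hc, hinv]
      exact tendsto_const_nhds
    · have hz : ∫ ω, conj (ψ ω) * (μ[F | invariantSigmaAlgebra g]) ω ∂μ = 0 := by
        rw [← integral_zero Ω ℂ]
        refine integral_congr_ae ?_
        filter_upwards [condExp_eq_zero_of_tendsto hg (hS F hFS) h0] with ω h
        simp [h]
      rw [hz]
      exact h0 ψ (Lp.memLp ψ)

/-! ## The Riemann–Lebesgue lemma along an absolutely continuous frequency -/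

/-- Conditioning on `w` replaces `ψ` by a function `H ∘ w`, since the exponential is bounded and
measurable with respect to `w`. What remains is the Fourier transform on `ℝ` of `H` times the
density of the law of `w`, to which the classical Riemann–Lebesgue lemma applies. -/
theorem tendsto_integral_exp_mul_of_map_absolutelyContinuous [IsFiniteMeasure μ] {w : Ω → ℝ}
    (hw : Measurable w) (hac : μ.map w ≪ volume) {ψ : Ω → ℂ} (hψ : Integrable ψ μ) :
    Tendsto (fun t : ℝ => ∫ ω, Complex.exp (t * w ω * Complex.I) * ψ ω ∂μ) atTop (𝓝 0) := by
  have hm : MeasurableSpace.comap w inferInstance ≤ m0 := hw.comap_le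
  obtain ⟨H, hHm, hH⟩ := (stronglyMeasurable_condExp (m := MeasurableSpace.comap w inferInstance)
      (μ := μ) (f := ψ)).exists_eq_measurable_comp
  have hwm : Measurable[MeasurableSpace.comap w inferInstance] w := comap_measurable w
  have h1 : ∀ t : ℝ, ∫ ω, Complex.exp (t * w ω * Complex.I) * ψ ω ∂μ
      = ∫ y : ℝ, Complex.exp (t * y * Complex.I) * (((μ.map w).rnDeriv volume y).toReal • H y) := by
    intro t
    have he : Measurable fun y : ℝ => Complex.exp (t * y * Complex.I) := by fun_prop
    have hpull := condExp_stronglyMeasurable_bilin_of_bound (μ := μ) (.mul ℝ ℂ) hm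
      (f := fun ω => Complex.exp (t * w ω * Complex.I)) (he.comp hwm).stronglyMeasurable hψ 1
      (Eventually.of_forall fun ω => by
        rw [← Complex.ofReal_mul, Complex.norm_exp_ofReal_mul_I])
    rw [← integral_condExp hm]
    rw [hH] at hpull
    simp only [ContinuousLinearMap.mul_apply'] at hpull
    rw [integral_congr_ae hpull]
    have h2 := integral_map (μ := μ) hw.aemeasurable
      (f := fun y => Complex.exp (t * y * Complex.I) * H y)
      (he.aestronglyMeasurable.mul hHm.aestronglyMeasurable)
    simp only [Function.comp_apply]
    rw [← h2, ← integral_rnDeriv_smul hac]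
    simp only [mul_smul_comm]
  simp_rw [h1]
  -- The factor `-1 / (2π)` translates from the kernel `exp (-2π i y s)` to `exp (i t y)`.
  have h3 := (Real.tendsto_integral_exp_smul_cocompact
    fun y => ((μ.map w).rnDeriv volume y).toReal • H y).comp
    (f := fun t : ℝ => -t * (2 * Real.pi)⁻¹) (x := atTop)
    ((tendsto_neg_atTop_atBot.atBot_mul_const (by positivity)).mono_right
      atBot_le_cocompact)
  refine h3.congr fun t => integral_congr_ae (Eventually.of_forall fun y => ?_)
  simp only [Circle.smul_def, Real.fourierChar_apply, smul_eq_mul]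
  congr 2
  push_cast
  field_simp

/-! ## Density of an algebra of functions in `L²` -/

/-- Stone–Weierstrass in `L²`: a family of bounded functions closed under products and conjugation
spans a dense subspace as soon as it contains countably many functions which generate the
σ-algebra up to null sets. -/
theorem mem_closure_span_of_generating [IsFiniteMeasure μ] {ι : Type*} [Countable ι]
    (f : ι → Ω → ℂ) (hfm : ∀ i, Measurable (f i)) (hfb : ∀ i ω, ‖f i ω‖ ≤ 1)
    (hgen : ∀ u : Ω → ℂ, Measurable u →
      ∃ G : (ι → ℂ) → ℂ, Measurable G ∧ u =ᵐ[μ] fun ω => G (fun i => f i ω))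
    (S : Set (Ω → ℂ)) (hone : 1 ∈ S) (hmul : ∀ F ∈ S, ∀ G ∈ S, F * G ∈ S)
    (hstar : ∀ F ∈ S, star F ∈ S) (hf : ∀ i, f i ∈ S) (u : Lp ℂ 2 μ) :
    u ∈ closure (Submodule.span ℂ {u : Lp ℂ 2 μ | ∃ F ∈ S, u =ᵐ[μ] F} : Set (Lp ℂ 2 μ)) := by
  let K := ι → closedBall (0 : ℂ) 1
  have : CompactSpace (closedBall (0 : ℂ) 1) :=
    isCompact_iff_compactSpace.1 (isCompact_closedBall 0 1)
  -- The generators send `Ω` into the compact product `K` of closed discs. Composition with `Φ` is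
  -- an isometry `T` of `L²` of the image measure into `L²(μ)`; it is onto because the generators
  -- determine every measurable function up to null sets.
  let Φ : Ω → K := fun ω i => ⟨f i ω, mem_closedBall_zero_iff.2 (hfb i ω)⟩
  have hΦ : Measurable Φ := measurable_pi_lambda _ fun i => (hfm i).subtype_mk
  have hmp : MeasurePreserving Φ μ (μ.map Φ) := hΦ.measurePreserving μ
  let T := Lp.compMeasurePreservingₗᵢ (E := ℂ) (p := 2) ℂ Φ hmp
  let L : C(K, ℂ) →L[ℂ] Lp ℂ 2 (μ.map Φ) := ContinuousMap.toLp 2 (μ.map Φ) ℂ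
  let W := Submodule.span ℂ {u : Lp ℂ 2 μ | ∃ F ∈ S, u =ᵐ[μ] F}
  let coord : ι → C(K, ℂ) := fun i => ⟨fun k => k i, by fun_prop⟩
  have hTL : ∀ c : C(K, ℂ), T (L c) =ᵐ[μ] fun ω => c (Φ ω) := fun c =>
    (Lp.coeFn_compMeasurePreserving _ hmp).trans
      (hmp.quasiMeasurePreserving.ae_eq_comp (ContinuousMap.coeFn_toLp _ c))
  have hA : ∀ c ∈ StarAlgebra.adjoin ℂ (Set.range coord), T (L c) ∈ W := by
    intro c hc
    have hc' : c ∈ Subalgebra.toSubmodule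
      (Algebra.adjoin ℂ (Set.range coord ∪ star (Set.range coord))) := hc
    rw [Algebra.adjoin_eq_span] at hc'
    clear hc
    -- `S` need not be closed under sums, so the adjoined algebra is handled as the linear span of
    -- the monomials in the coordinates and their conjugates.
    have hmon : ∀ d ∈ Submonoid.closure (Set.range coord ∪ star (Set.range coord)),
        (fun ω => d (Φ ω)) ∈ S := by
      intro d hd
      induction hd using Submonoid.closure_induction with
      | mem d hd =>
        rcases hd with ⟨i, rfl⟩ | ⟨i, hi⟩
        · exact hf i
        · have : d = star (coord i) := by rw [hi, star_star]
          rw [this]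
          exact hstar _ (hf i)
      | one => exact hone
      | mul a b _ _ ha hb => exact hmul _ ha _ hb
    induction hc' using Submodule.span_induction with
    | mem d hd => exact Submodule.subset_span ⟨_, hmon d hd, hTL d⟩
    | zero => simp
    | add a b _ _ ha hb => simpa only [map_add] using W.add_mem ha hb
    | smul r a _ ha => simpa only [map_smul] using W.smul_mem r ha
  have hsep : (StarAlgebra.adjoin ℂ (Set.range coord)).SeparatesPoints := by
    intro x y hxy
    obtain ⟨i, hi⟩ := Function.ne_iff.1 hxy
    exact ⟨coord i, ⟨coord i, StarAlgebra.subset_adjoin ℂ _ ⟨i, rfl⟩, rfl⟩,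
      fun h => hi (Subtype.ext h)⟩
  have hdense := ContinuousMap.starSubalgebra_topologicalClosure_eq_top_of_separatesPoints _ hsep
  have hall : ∀ c : C(K, ℂ), T (L c) ∈ closure (W : Set (Lp ℂ 2 μ)) := by
    intro c
    have hc : c ∈ closure (StarAlgebra.adjoin ℂ (Set.range coord) : Set C(K, ℂ)) := by
      rw [← StarSubalgebra.topologicalClosure_coe, hdense]
      trivial
    exact map_mem_closure (f := fun c => T (L c)) (T.continuous.comp L.continuous) hc hA
  obtain ⟨G, hG, hGu⟩ := hgen u (Lp.stronglyMeasurable u).measurable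
  let G' : K → ℂ := fun k => G fun i => k i
  have hG' : Measurable G' := hG.comp (by fun_prop)
  have hGL : MemLp G' 2 (μ.map Φ) := by
    rw [memLp_map_measure_iff hG'.aestronglyMeasurable hΦ.aemeasurable]
    exact (memLp_congr_ae hGu).1 (Lp.memLp u)
  have hu : u = T (hGL.toLp G') := by
    refine Lp.ext (hGu.trans ?_)
    exact ((Lp.coeFn_compMeasurePreserving _ hmp).trans
      (hmp.quasiMeasurePreserving.ae_eq_comp hGL.coeFn_toLp)).symm
  have hr : hGL.toLp G' ∈ closure (Set.range L) :=
    ContinuousMap.toLp_denseRange ℂ (μ.map Φ) ℂ (by simp) _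
  rw [hu, ← closure_closure]
  exact map_mem_closure T.continuous hr (by rintro _ ⟨c, rfl⟩; exact hall c)

end General

/-! ## Preimages of null sets -/

/-- The preimage of a null set under a function with nonzero derivative is a null set. -/
theorem volume_inter_preimage_eq_zero {f f' : ℝ → ℝ} {s : Set ℝ} (hs : MeasurableSet s)
    (hfm : Measurable f) (hf : ∀ x ∈ s, HasStrictDerivAt f (f' x) x) (hf' : ∀ x ∈ s, f' x ≠ 0)
    {N : Set ℝ} (hN : volume N = 0) : volume (s ∩ f ⁻¹' N) = 0 := by
  refine measure_null_of_locally_null _ fun x hx => ?_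
  let e := ((hf x hx.1).hasStrictFDerivAt_equiv (hf' x hx.1)).toOpenPartialHomeomorph f
  have hxe : x ∈ e.source :=
    ((hf x hx.1).hasStrictFDerivAt_equiv (hf' x hx.1)).mem_toOpenPartialHomeomorph_source
  refine ⟨s ∩ f ⁻¹' N ∩ e.source,
    inter_mem_nhdsWithin _ (e.open_source.mem_nhds hxe), ?_⟩
  -- On `e.source` the function is injective, so the integral of `|f'|` over `A` is the volume of
  -- the null set `f '' A`; as `f'` does not vanish on `A`, `A` is null. The measurable hull is
  -- there because `N` itself may be non-measurable.
  let A := s ∩ f ⁻¹' toMeasurable volume N ∩ e.source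
  have hA : MeasurableSet A :=
    (hs.inter (hfm (measurableSet_toMeasurable _ _))).inter e.open_source.measurableSet
  have hd : ∀ y ∈ A, HasDerivAt f (deriv f y) y := fun y hy =>
    (hf y hy.1.1).hasDerivAt.differentiableAt.hasDerivAt
  have hint := lintegral_image_eq_lintegral_abs_deriv_mul hA
    (fun y hy => (hd y hy).hasDerivWithinAt) (e.injOn.mono fun y hy => hy.2) 1
  have himage : volume (f '' A) = 0 := by
    refine measure_mono_null ?_ ((measure_toMeasurable N).trans hN)
    rintro _ ⟨y, hy, rfl⟩
    exact hy.1.2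
  simp only [Pi.one_apply, lintegral_one, Measure.restrict_apply_univ, mul_one] at hint
  rw [himage, eq_comm, lintegral_eq_zero_iff (by fun_prop), EventuallyEq,
    ae_restrict_iff' hA, ae_iff] at hint
  refine measure_mono_null (t := A) ?_ (measure_mono_null ?_ hint)
  · exact Set.inter_subset_inter_left _
      (Set.inter_subset_inter_right _ (Set.preimage_mono (subset_toMeasurable _ _)))
  · intro y hy h
    have h0 := h hy
    rw [(hf y hy.1.1).hasDerivAt.deriv] at h0
    simp only [Pi.zero_apply, ENNReal.ofReal_eq_zero, abs_nonpos_iff] at h0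
    exact hf' y hy.1.1 h0

/-! ## The flow property -/

section Dynamics

variable {n : ℕ}

theorem halfChord_nonneg (p : PosVel n) : 0 ≤ halfChord p := Real.sqrt_nonneg _

theorem halfChord_pos {p : PosVel n} (h : halfChord p ≠ 0) : 0 < halfChord p :=
  lt_of_le_of_ne (halfChord_nonneg p) h.symm

theorem norm_vel (p : PosVel n) : ‖(p.2 : E n)‖ = 1 := norm_eq_of_mem_sphere p.2

theorem chord_lastCollision {p : PosVel n} (h : halfChord p ≠ 0) :
    chord (lastCollision p h) = 2 * halfChord p := by
  change -2 * ⟪(p.1 : E n) - age p • (p.2 : E n), (p.2 : E n)⟫ = _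
  rw [sub_eq_add_neg, ← neg_smul, inner_add_smul (norm_vel p), age]
  ring

/-- A state is determined on its chord by the time elapsed since the collision. -/
theorem halfChord_of_eq_add_smul {a : Inward n} {r : ℝ} {p : PosVel n}
    (h1 : (p.1 : E n) = a.1.1 + r • a.1.2) (h2 : (p.2 : E n) = a.1.2) :
    halfChord p = chord a / 2 := by
  rw [halfChord, h1, h2, inner_add_smul a.2.2.1, norm_add_smul_sq a.2.2.1, a.2.1,
    ← Real.sqrt_sq (half_pos (chord_pos a)).le, chord]
  congr 1
  ring

theorem age_of_eq_add_smul {a : Inward n} {r : ℝ} {p : PosVel n}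
    (h1 : (p.1 : E n) = a.1.1 + r • a.1.2) (h2 : (p.2 : E n) = a.1.2) : age p = r := by
  rw [age, halfChord_of_eq_add_smul h1 h2, h1, h2, inner_add_smul a.2.2.1, chord]
  ring

theorem lastCollision_of_eq_add_smul {a : Inward n} {r : ℝ} {p : PosVel n}
    (h1 : (p.1 : E n) = a.1.1 + r • a.1.2) (h2 : (p.2 : E n) = a.1.2) (h : halfChord p ≠ 0) :
    lastCollision p h = a := by
  apply Subtype.ext
  refine Prod.ext ?_ h2
  change (p.1 : E n) - age p • (p.2 : E n) = a.1.1
  rw [age_of_eq_add_smul h1 h2, h1, h2, add_sub_cancel_right]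

theorem halfChord_afterCollision (a : Inward n) (u : ℝ) :
    halfChord (afterCollision a u) = chord a / 2 := by
  rw [halfChord_of_eq_add_smul (a := (billiardMap n ^ ⌊u / chord a⌋) a) rfl rfl,
    chord_billiardMap_zpow]

theorem age_afterCollision (a : Inward n) (u : ℝ) :
    age (afterCollision a u) = u - ⌊u / chord a⌋ * chord a :=
  age_of_eq_add_smul (a := (billiardMap n ^ ⌊u / chord a⌋) a) rfl rfl

theorem lastCollision_afterCollision (a : Inward n) (u : ℝ)
    (h : halfChord (afterCollision a u) ≠ 0) :
    lastCollision (afterCollision a u) h = (billiardMap n ^ ⌊u / chord a⌋) a :=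
  lastCollision_of_eq_add_smul rfl rfl h

/-- Because all chords of a trajectory have equal length, restarting the clock at the `k`-th
collision only shifts time by `k` chords. This absorbs the integer parts in the group law. -/
theorem afterCollision_billiardMap_zpow (k : ℤ) (a : Inward n) (u : ℝ) :
    afterCollision ((billiardMap n ^ k) a) u = afterCollision a (k * chord a + u) := by
  induction k using Int.induction_on generalizing u with
  | zero => simp
  | succ k ih =>
    have h := afterCollision_nextCollision ((billiardMap n ^ (k : ℤ)) a) u
    rw [ih, chord_billiardMap_zpow] at h
    rw [add_comm, zpow_add, zpow_one, Equiv.Perm.mul_apply]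
    refine h.trans (congrArg _ ?_)
    push_cast
    ring
  | pred k ih =>
    have h := afterCollision_nextCollision ((billiardMap n ^ (-(k : ℤ) - 1)) a) (u - chord a)
    have h' : nextCollision ((billiardMap n ^ (-(k : ℤ) - 1)) a)
        = (billiardMap n ^ (-(k : ℤ))) a := by
      conv_rhs => rw [show -(k : ℤ) = 1 + (-(k : ℤ) - 1) by ring, zpow_add, zpow_one,
        Equiv.Perm.mul_apply]
      rfl
    rw [h', ih, chord_billiardMap_zpow, add_sub_cancel] at h
    rw [← h]
    congr 1
    push_cast
    ring

theorem evolve_of_ne {p : PosVel n} (h : halfChord p ≠ 0) (t : ℝ) :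
    evolve t p = afterCollision (lastCollision p h) (age p + t) := dif_neg h

theorem evolve_of_eq {p : PosVel n} (h : halfChord p = 0) (t : ℝ) :
    evolve t p = glide p h t := dif_pos h

theorem halfChord_glide {p : PosVel n} (h : halfChord p = 0) (t : ℝ) :
    halfChord (glide p h t) = 0 := by
  obtain ⟨hx, hxv⟩ := grazing_of_halfChord_eq_zero h
  have h1 : ‖((glide p h t).1 : E n)‖ = 1 :=
    norm_rotate hx (norm_vel p) hxv (Real.cos_sq_add_sin_sq t)
  have h2 : ⟪((glide p h t).1 : E n), ((glide p h t).2 : E n)⟫ = 0 := by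
    change ⟪Real.cos t • (p.1 : E n) + Real.sin t • (p.2 : E n),
      -Real.sin t • (p.1 : E n) + Real.cos t • (p.2 : E n)⟫ = 0
    simp only [inner_add_left, inner_add_right, real_inner_smul_left, inner_smul_right, hxv,
      real_inner_self_eq_norm_sq, hx, norm_vel p, real_inner_comm (p.1 : E n) (p.2 : E n)]
    ring
  rw [halfChord, h1, h2]
  simp

theorem halfChord_evolve (t : ℝ) (p : PosVel n) : halfChord (evolve t p) = halfChord p := by
  by_cases h : halfChord p = 0
  · rw [evolve_of_eq h, halfChord_glide h, h]
  · rw [evolve_of_ne h, halfChord_afterCollision, chord_lastCollision h]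
    ring

theorem age_evolve {p : PosVel n} (h : halfChord p ≠ 0) (t : ℝ) :
    age (evolve t p) = age p + t - ⌊(age p + t) / (2 * halfChord p)⌋ * (2 * halfChord p) := by
  rw [evolve_of_ne h, age_afterCollision, chord_lastCollision h]

theorem lastCollision_evolve {p : PosVel n} (h : halfChord p ≠ 0) (t : ℝ)
    (h' : halfChord (evolve t p) ≠ 0) :
    lastCollision (evolve t p) h' =
      (billiardMap n ^ ⌊(age p + t) / (2 * halfChord p)⌋) (lastCollision p h) := by
  simp only [evolve_of_ne h, lastCollision_afterCollision, chord_lastCollision h]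

/-- After time `t` the age has dropped by `k` chords and the last collision has moved on by `k`
iterates; the two changes compensate. The law holds for pairs, before passing to the quotient,
whereas time zero is the identity only up to a collision. -/
theorem evolve_evolve (s t : ℝ) (p : PosVel n) : evolve s (evolve t p) = evolve (s + t) p := by
  by_cases h : halfChord p = 0
  · have h' : halfChord (evolve t p) = 0 := (halfChord_evolve t p).trans h
    rw [evolve_of_eq h' s, evolve_of_eq h (s + t)]
    have e1 : ((evolve t p).1 : E n) = Real.cos t • (p.1 : E n) + Real.sin t • (p.2 : E n) := by
      rw [evolve_of_eq h]; rfl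
    have e2 : ((evolve t p).2 : E n) = -Real.sin t • (p.1 : E n) + Real.cos t • (p.2 : E n) := by
      rw [evolve_of_eq h]; rfl
    refine Prod.ext (Subtype.ext ?_) (Subtype.ext ?_)
    · change Real.cos s • ((evolve t p).1 : E n) + Real.sin s • ((evolve t p).2 : E n)
        = Real.cos (s + t) • (p.1 : E n) + Real.sin (s + t) • (p.2 : E n)
      rw [e1, e2, Real.cos_add, Real.sin_add]
      module
    · change -Real.sin s • ((evolve t p).1 : E n) + Real.cos s • ((evolve t p).2 : E n)
        = -Real.sin (s + t) • (p.1 : E n) + Real.cos (s + t) • (p.2 : E n)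
      rw [e1, e2, Real.cos_add, Real.sin_add]
      module
  · have h' : halfChord (evolve t p) ≠ 0 := by rwa [halfChord_evolve]
    rw [evolve_of_ne h', lastCollision_evolve h, afterCollision_billiardMap_zpow, age_evolve h,
      evolve_of_ne h, chord_lastCollision h]
    congr 1
    ring

/-- A state is at its own place on its chord, up to the identification of the two velocities at the
end of the chord. -/
theorem evolve_zero (p : PosVel n) : evolve 0 p = p ∨ evolve 0 p = collide p := by
  by_cases h : halfChord p = 0
  · left
    rw [evolve_of_eq h]
    refine Prod.ext (Subtype.ext ?_) (Subtype.ext ?_) <;> simp [glide]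
  have hx : (lastCollision p h).1.1 + age p • (lastCollision p h).1.2 = (p.1 : E n) := by
    simp [lastCollision]
  have hpos := halfChord_pos h
  have hle : ‖(p.1 : E n)‖ ^ 2 ≤ 1 :=
    (sq_le_one_iff₀ (norm_nonneg _)).2 (mem_closedBall_zero_iff.1 p.1.2)
  have hsq := sq_halfChord p
  have hb : |⟪(p.1 : E n), (p.2 : E n)⟫| ≤ halfChord p :=
    abs_le_of_sq_le_sq (by nlinarith) hpos.le
  rw [abs_le] at hb
  -- Equality means an outgoing velocity on the boundary: the age is then a full chord, the integer
  -- part jumps to `1`, and `evolve 0` performs the reflection.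
  rcases hb.2.lt_or_eq with hlt | heq
  · left
    have hk : ⌊age p / chord (lastCollision p h)⌋ = 0 := by
      rw [Int.floor_eq_zero_iff, chord_lastCollision h]
      refine ⟨div_nonneg ?_ (by linarith), (div_lt_one (by linarith)).2 ?_⟩ <;>
      · unfold age; linarith
    rw [evolve_of_ne h, add_zero]
    refine Prod.ext (Subtype.ext ?_) (Subtype.ext ?_)
    · simp only [afterCollision, hk, zpow_zero, Equiv.Perm.one_apply, Int.cast_zero, zero_mul,
        sub_zero, hx]
    · simp only [afterCollision, hk, zpow_zero, Equiv.Perm.one_apply]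
      rfl
  · right
    have hage : age p = chord (lastCollision p h) := by
      rw [chord_lastCollision h, age, heq]
      ring
    have hnorm : ‖(p.1 : E n)‖ = 1 := norm_eq_one_of_sq (by rw [← heq] at hsq; linarith)
    have hnext : (nextCollision (lastCollision p h)).1
        = ((p.1 : E n), reflect (p.1 : E n) (p.2 : E n)) := by
      refine Prod.ext ?_ ?_
      · change (lastCollision p h).1.1 + chord (lastCollision p h) • (lastCollision p h).1.2 = _
        rw [← hage, hx]
      · change reflect ((lastCollision p h).1.1 + chord (lastCollision p h) •
          (lastCollision p h).1.2) (p.2 : E n) = _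
        rw [← hage, hx]
    have h0 : evolve 0 p = afterCollision (nextCollision (lastCollision p h)) 0 := by
      rw [afterCollision_nextCollision, evolve_of_ne h, hage]
    rw [h0]
    refine Prod.ext (Subtype.ext ?_) (Subtype.ext ?_)
    · simp [afterCollision, hnext, collide, hnorm]
    · simp [afterCollision, hnext, collide, hnorm]

theorem billiardFlow_mk (t : ℝ) (p : PosVel n) :
    billiardFlow n t (Quotient.mk (collisionSetoid n) p)
      = Quotient.mk (collisionSetoid n) (evolve t p) := rfl

theorem billiardFlow_zero : billiardFlow n 0 = id := by
  funext ω
  induction ω using Quotient.inductionOn with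
  | h p =>
    rw [billiardFlow_mk, id]
    refine Quotient.sound ?_
    rcases evolve_zero p with h | h
    · exact Or.inl h.symm
    · exact Or.inr (by rw [h, collide_collide])

theorem billiardFlow_add (s t : ℝ) :
    billiardFlow n (s + t) = billiardFlow n s ∘ billiardFlow n t := by
  funext ω
  induction ω using Quotient.inductionOn with
  | h p => simp only [Function.comp_apply, billiardFlow_mk, evolve_evolve]

/-! ## Measurability of the flow -/

@[fun_prop]
theorem continuous_halfChord : Continuous (halfChord : PosVel n → ℝ) := by
  unfold halfChord
  fun_prop

@[fun_prop]
theorem continuous_age : Continuous (age : PosVel n → ℝ) := by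
  unfold age
  fun_prop

@[fun_prop]
theorem continuous_chord : Continuous (chord : Inward n → ℝ) := by
  unfold chord
  fun_prop

theorem continuous_nextCollision : Continuous (nextCollision : Inward n → Inward n) := by
  unfold nextCollision reflect
  fun_prop

theorem continuous_prevCollision : Continuous (prevCollision : Inward n → Inward n) := by
  unfold prevCollision reflect
  fun_prop

theorem continuous_billiardMap_zpow (k : ℤ) :
    Continuous fun a : Inward n => (billiardMap n ^ k) a := by
  induction k using Int.induction_on with
  | zero => simpa using! continuous_id
  | succ k ih =>
    simp only [add_comm (k : ℤ) 1, zpow_add, zpow_one, Equiv.Perm.mul_apply]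
    exact continuous_nextCollision.comp ih
  | pred k ih =>
    simp only [sub_eq_neg_add, zpow_add, zpow_neg_one, Equiv.Perm.mul_apply]
    exact continuous_prevCollision.comp ih

/-- The number of collisions is a discontinuous function, but it takes countably many values and
each iterate of the billiard map is continuous. -/
theorem measurable_afterCollision :
    Measurable fun q : Inward n × ℝ => afterCollision q.1 q.2 := by
  have hc : Measurable fun q : ℤ × Inward n => (billiardMap n ^ q.1) q.2 :=
    measurable_from_prod_countable_right fun k => (continuous_billiardMap_zpow k).measurable
  have hchord : Measurable fun q : Inward n × ℝ => chord q.1 := by fun_prop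
  have hk : Measurable fun q : Inward n × ℝ => ⌊q.2 / chord q.1⌋ :=
    (measurable_snd.div hchord).floor
  have hc' : Measurable fun q : Inward n × ℝ => (billiardMap n ^ ⌊q.2 / chord q.1⌋) q.1 :=
    hc.comp (hk.prodMk measurable_fst)
  have hk' : Measurable fun q : Inward n × ℝ => (⌊q.2 / chord q.1⌋ : ℝ) :=
    measurable_from_top.comp hk
  unfold afterCollision
  refine Measurable.prodMk (Measurable.subtype_mk ?_) (Measurable.subtype_mk ?_)
  · exact (measurable_fst.comp (measurable_subtype_coe.comp hc')).add
      ((measurable_snd.sub (hk'.mul hchord)).smul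
        (measurable_snd.comp (measurable_subtype_coe.comp hc')))
  · exact measurable_snd.comp (measurable_subtype_coe.comp hc')

theorem measurable_evolve (t : ℝ) : Measurable (evolve t : PosVel n → PosVel n) := by
  have hs : MeasurableSet {p : PosVel n | halfChord p = 0} :=
    (isClosed_eq continuous_halfChord continuous_const).measurableSet
  have h1 : Measurable fun p : {p : PosVel n | halfChord p = 0} => glide p.1 p.2 t := by
    unfold glide
    fun_prop
  have h2 : Measurable fun p : ({p : PosVel n | halfChord p = 0}ᶜ : Set (PosVel n)) =>
      afterCollision (lastCollision p.1 p.2) (age p.1 + t) := by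
    have hl : Measurable fun p : ({p : PosVel n | halfChord p = 0}ᶜ : Set (PosVel n)) =>
        (lastCollision p.1 p.2, age p.1 + t) := by
      refine Measurable.prodMk ?_ (by fun_prop)
      unfold lastCollision
      fun_prop
    have hcomp := measurable_afterCollision.comp hl
    simp only [Function.comp_def] at hcomp
    exact hcomp
  refine measurable_of_restrict_of_restrict_compl hs ?_ ?_
  · have : Set.domRestrict {p : PosVel n | halfChord p = 0} (evolve t) = fun p => glide p.1 p.2 t :=
      funext fun p => evolve_of_eq p.2 t
    rwa [this]
  · have : Set.domRestrict {p : PosVel n | halfChord p = 0}ᶜ (evolve t) =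
        fun p => afterCollision (lastCollision p.1 p.2) (age p.1 + t) :=
      funext fun p => evolve_of_ne p.2 t
    rwa [this]

theorem measurable_mk : Measurable (Quotient.mk (collisionSetoid n)) := measurable_quotient_mk''

theorem measurable_billiardFlow (t : ℝ) : Measurable (billiardFlow n t) :=
  measurable_from_quotient.2 (measurable_mk.comp (measurable_evolve t))

end Dynamics

/-! ## Angle variables and eigenfunctions -/

section Angles

variable {n : ℕ}

/-- The `j`-th coordinate of the complex vector which encodes the chord through `x` in the
direction `v`, for a half-chord of length `h`. A rotation in the plane of the chord multiplies it
by a complex number of modulus one. -/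
noncomputable def planeCoord (h : ℝ) (x v : E n) (j : Fin n) : ℂ :=
  h * (√(1 - h ^ 2) * (v j : ℝ) + Complex.I * ((x - ⟪x, v⟫ • v) j : ℝ))

/-- The vector `x - ⟪x, v⟫ v` is the foot of the perpendicular from the centre to the chord, which
does not change when `x` moves along the chord. -/
theorem planeCoord_add_smul (h : ℝ) (x : E n) {v : E n} (hv : ‖v‖ = 1) (s : ℝ) (j : Fin n) :
    planeCoord h (x + s • v) v j = planeCoord h x v j := by
  have : x + s • v - ⟪x + s • v, v⟫ • v = x - ⟪x, v⟫ • v := by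
    rw [inner_add_smul hv]
    module
  rw [planeCoord, planeCoord, this]

theorem halfChord_le_one (p : PosVel n) : halfChord p ≤ 1 := by
  refine Real.sqrt_le_iff.2 ⟨zero_le_one, ?_⟩
  have h := abs_real_inner_le_norm (p.1 : E n) (p.2 : E n)
  rw [norm_vel, mul_one] at h
  have := sq_le_sq' (by linarith [neg_abs_le ⟪(p.1 : E n), (p.2 : E n)⟫, h])
    ((le_abs_self _).trans h)
  linarith

theorem chord_le_two (a : Inward n) : chord a / 2 ≤ 1 := by
  have h := abs_real_inner_le_norm a.1.1 a.1.2
  rw [a.2.1, a.2.2.1, abs_le] at h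
  unfold chord
  linarith

theorem exp_two_arcsin {h : ℝ} (h0 : 0 ≤ h) (h1 : h ≤ 1) :
    Complex.exp (2 * Real.arcsin h * Complex.I) =
      (1 - 2 * h ^ 2 : ℝ) + (2 * h * √(1 - h ^ 2) : ℝ) * Complex.I := by
  have e : (2 * Real.arcsin h * Complex.I : ℂ) = ((2 * Real.arcsin h : ℝ) : ℂ) * Complex.I := by
    push_cast
    ring
  rw [e, Complex.exp_mul_I, ← Complex.ofReal_cos, ← Complex.ofReal_sin, Real.cos_two_mul,
    Real.sin_two_mul, Real.sin_arcsin (by linarith) h1, Real.cos_arcsin,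
    Real.sq_sqrt (by nlinarith)]
  push_cast
  ring

/-- A chord of length `2h` subtends the angle `2 arcsin h` at the centre, and the next chord is its
image under the rotation by this angle. The foot `c` of the perpendicular has norm `√(1 - h²)`, so
`√(1 - h²) v + i c` is an eigenvector of the complexified rotation. With this weight there is no
division by `‖c‖`, which vanishes on diameters; the extra factor `h` kills the coordinate on grazing
states. -/
theorem planeCoord_nextCollision (a : Inward n) (j : Fin n) :
    planeCoord (chord a / 2) (nextCollision a).1.1 (nextCollision a).1.2 j =
      Complex.exp (2 * Real.arcsin (chord a / 2) * Complex.I) *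
        planeCoord (chord a / 2) a.1.1 a.1.2 j := by
  have hle := chord_le_two a
  have hpos := chord_pos a
  rw [exp_two_arcsin (by linarith) hle]
  set h := chord a / 2 with hh
  have hc : chord a = 2 * h := by rw [hh]; ring
  have hi : ⟪a.1.1, a.1.2⟫ = -h := by rw [hh, chord]; ring
  have hs : √(1 - h ^ 2) ^ 2 = 1 - h ^ 2 := Real.sq_sqrt (by nlinarith)
  have h1 : (nextCollision a).1.1 = a.1.1 + (2 * h) • a.1.2 := by rw [← hc]; rfl
  have h2 : (nextCollision a).1.2 = -(2 * h) • a.1.1 + (1 - 4 * h ^ 2) • a.1.2 := by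
    change reflect (a.1.1 + chord a • a.1.2) a.1.2 = _
    rw [reflect, inner_chord_end, hc, hi]
    module
  have h3 : ⟪(nextCollision a).1.1, (nextCollision a).1.2⟫ = -h := by
    have := chord_nextCollision a
    rw [hc] at this
    unfold chord at this
    linarith
  rw [planeCoord, planeCoord, h3, h1, h2, hi]
  simp only [PiLp.add_apply, PiLp.sub_apply, PiLp.smul_apply, smul_eq_mul]
  generalize a.1.1 j = x
  generalize a.1.2 j = v
  generalize √(1 - h ^ 2) = r at hs ⊢
  have hs' : (r : ℂ) ^ 2 = 1 - (h : ℂ) ^ 2 := by exact_mod_cast congrArg Complex.ofReal hs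
  have hI : Complex.I ^ 2 = -1 := Complex.I_sq
  push_cast
  linear_combination (-2 * h ^ 2 * v * Complex.I) * hs' - (2 * h ^ 2 * r * (x + h * v)) * hI

theorem planeCoord_billiardMap_zpow (k : ℤ) (a : Inward n) (j : Fin n) :
    planeCoord (chord a / 2) ((billiardMap n ^ k) a).1.1 ((billiardMap n ^ k) a).1.2 j =
      Complex.exp (k * (2 * Real.arcsin (chord a / 2) * Complex.I)) *
        planeCoord (chord a / 2) a.1.1 a.1.2 j := by
  induction k using Int.induction_on with
  | zero => simp
  | succ k ih =>
    have h := planeCoord_nextCollision ((billiardMap n ^ (k : ℤ)) a) j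
    rw [chord_billiardMap_zpow, ih, ← mul_assoc, ← Complex.exp_add] at h
    rw [add_comm (k : ℤ) 1, zpow_add, zpow_one, Equiv.Perm.mul_apply]
    refine h.trans ?_
    congr 2
    push_cast
    ring
  | pred k ih =>
    have h := planeCoord_nextCollision ((billiardMap n ^ (-(k : ℤ) - 1)) a) j
    have h' : nextCollision ((billiardMap n ^ (-(k : ℤ) - 1)) a)
        = (billiardMap n ^ (-(k : ℤ))) a := by
      conv_rhs => rw [show -(k : ℤ) = 1 + (-(k : ℤ) - 1) by ring, zpow_add, zpow_one,
        Equiv.Perm.mul_apply]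
      rfl
    rw [h', chord_billiardMap_zpow, ih] at h
    rw [← mul_right_inj' (Complex.exp_ne_zero (2 * Real.arcsin (chord a / 2) * Complex.I)), ← h,
      ← mul_assoc (Complex.exp _) (Complex.exp _), ← Complex.exp_add]
    congr 2
    push_cast
    ring

/-- The frequencies of the motion on the states of half-chord `h`. -/
noncomputable def frequency (k m : ℤ) (h : ℝ) : ℝ := (k * Real.pi + m * Real.arcsin h) / h

/-- The phase of the motion along the chord. -/
noncomputable def chordPhase (p : PosVel n) : ℂ :=
  Complex.exp (age p * frequency 1 0 (halfChord p) * Complex.I)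

/-- The chord, followed in a frame which rotates with the motion. -/
noncomputable def planePhase (j : Fin n) (p : PosVel n) : ℂ :=
  Complex.exp (age p * frequency 0 1 (halfChord p) * Complex.I) *
    planeCoord (halfChord p) (p.1 : E n) (p.2 : E n) j

/-- A collision lowers the age by `2h`, a period of `exp (i π age / h)`, so the phase does not see
collisions. -/
theorem chordPhase_evolve (t : ℝ) (p : PosVel n) : chordPhase (evolve t p) =
    Complex.exp (t * frequency 1 0 (halfChord p) * Complex.I) * chordPhase p := by
  rw [chordPhase, chordPhase, halfChord_evolve]
  by_cases h : halfChord p = 0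
  -- For grazing states the division by zero makes the frequency `0`, and the phase is constantly
  -- `1`.
  · simp [h, frequency]
  rw [age_evolve h, ← Complex.exp_add, Complex.exp_eq_exp_iff_exists_int]
  refine ⟨-⌊(age p + t) / (2 * halfChord p)⌋, ?_⟩
  generalize ⌊(age p + t) / (2 * halfChord p)⌋ = k
  have : (halfChord p : ℂ) ≠ 0 := by exact_mod_cast h
  simp only [frequency]
  push_cast
  field_simp
  ring

/-- At a collision the drop of the age by `2h` contributes `exp (-2 i arcsin h)`, which cancels the
factor gained by `planeCoord`. Only the steady growth of the age along the chords remains. -/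
theorem planePhase_evolve (j : Fin n) (t : ℝ) (p : PosVel n) : planePhase j (evolve t p) =
    Complex.exp (t * frequency 0 1 (halfChord p) * Complex.I) * planePhase j p := by
  rw [planePhase, planePhase, halfChord_evolve]
  by_cases h : halfChord p = 0
  -- The gliding motion does rotate while the frequency is `0` there; the relation survives thanks
  -- to the factor `h` in `planeCoord`.
  · simp [h, planeCoord]
  have hpc : ∀ q : PosVel n, ∀ hq : halfChord q ≠ 0,
      planeCoord (halfChord q) (q.1 : E n) (q.2 : E n) j =
      planeCoord (halfChord q) (lastCollision q hq).1.1 (lastCollision q hq).1.2 j := by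
    intro q hq
    rw [← planeCoord_add_smul _ _ (lastCollision q hq).2.2.1 (age q)]
    simp [lastCollision]
  have h' : halfChord (evolve t p) ≠ 0 := by rwa [halfChord_evolve]
  have hc : halfChord p = chord (lastCollision p h) / 2 := by
    rw [chord_lastCollision]
    ring
  have h1 := hpc _ h'
  rw [lastCollision_evolve h, halfChord_evolve] at h1
  rw [h1, hpc p h]
  conv_lhs => rw [hc]
  rw [planeCoord_billiardMap_zpow, ← hc, ← mul_assoc (Complex.exp _) (Complex.exp _),
    ← mul_assoc (Complex.exp _) (Complex.exp _), ← Complex.exp_add, ← Complex.exp_add,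
    age_evolve h]
  congr 2
  generalize ⌊(age p + t) / (2 * halfChord p)⌋ = k
  have : (halfChord p : ℂ) ≠ 0 := by exact_mod_cast h
  simp only [frequency]
  push_cast
  field_simp
  ring

theorem norm_chordPhase (p : PosVel n) : ‖chordPhase p‖ = 1 := by
  rw [chordPhase, ← Complex.ofReal_mul, Complex.norm_exp_ofReal_mul_I]

theorem norm_offset_sq (p : PosVel n) :
    ‖(p.1 : E n) - ⟪(p.1 : E n), (p.2 : E n)⟫ • (p.2 : E n)‖ ^ 2 = 1 - halfChord p ^ 2 := by
  rw [sub_eq_add_neg, ← neg_smul, norm_add_smul_sq (norm_vel p), sq_halfChord]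
  ring

theorem norm_planePhase_le (j : Fin n) (p : PosVel n) : ‖planePhase j p‖ ≤ 1 := by
  rw [planePhase, ← Complex.ofReal_mul, norm_mul, Complex.norm_exp_ofReal_mul_I, one_mul,
    planeCoord, norm_mul, Complex.norm_real, Real.norm_of_nonneg (halfChord_nonneg p)]
  have h0 := halfChord_nonneg p
  have h1 := halfChord_le_one p
  have hs : √(1 - halfChord p ^ 2) ^ 2 = 1 - halfChord p ^ 2 := Real.sq_sqrt (by nlinarith)
  set c := (p.1 : E n) - ⟪(p.1 : E n), (p.2 : E n)⟫ • (p.2 : E n) with hc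
  have hcj : |c j| ≤ √(1 - halfChord p ^ 2) := by
    rw [← norm_offset_sq, Real.sqrt_sq (norm_nonneg _)]
    exact PiLp.norm_apply_le c j
  have hvj : |(p.2 : E n) j| ≤ 1 :=
    (PiLp.norm_apply_le (p.2 : E n) j).trans_eq (norm_vel p)
  have hb : ‖(√(1 - halfChord p ^ 2) * ((p.2 : E n) j : ℝ) + Complex.I * (c j : ℝ) : ℂ)‖ ≤
      2 * √(1 - halfChord p ^ 2) := by
    refine (norm_add_le _ _).trans ?_
    rw [norm_mul, norm_mul, Complex.norm_I, Complex.norm_real, Complex.norm_real,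
      Complex.norm_real, Real.norm_of_nonneg (Real.sqrt_nonneg _), Real.norm_eq_abs,
      Real.norm_eq_abs]
    nlinarith [Real.sqrt_nonneg (1 - halfChord p ^ 2)]
  have := mul_le_mul_of_nonneg_left hb h0
  -- This is `2 h √(1 - h²) ≤ h² + (1 - h²) = 1`.
  nlinarith [sq_nonneg (halfChord p - √(1 - halfChord p ^ 2))]

@[fun_prop]
theorem measurable_frequency (k m : ℤ) : Measurable (frequency k m) := by
  unfold frequency
  exact (measurable_const.add (measurable_const.mul Real.measurable_arcsin)).div measurable_id

theorem measurable_halfChord : Measurable (halfChord : PosVel n → ℝ) :=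
  continuous_halfChord.measurable

theorem measurable_age : Measurable (age : PosVel n → ℝ) := continuous_age.measurable

theorem measurable_chordPhase : Measurable (chordPhase : PosVel n → ℂ) := by
  have h1 := measurable_age (n := n)
  have h2 := (measurable_frequency 1 0).comp (measurable_halfChord (n := n))
  simp only [Function.comp_def] at h2
  unfold chordPhase
  fun_prop

theorem measurable_planePhase (j : Fin n) : Measurable (planePhase j : PosVel n → ℂ) := by
  have h1 := measurable_age (n := n)
  have h2 := (measurable_frequency 0 1).comp (measurable_halfChord (n := n))
  have h3 := measurable_halfChord (n := n)
  simp only [Function.comp_def] at h2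
  have h4 : Measurable fun p : PosVel n => ((p.1 : E n) -
      ⟪(p.1 : E n), (p.2 : E n)⟫ • (p.2 : E n)) j :=
    Continuous.measurable (by fun_prop)
  have h5 : Measurable fun p : PosVel n => (p.2 : E n) j := Continuous.measurable (by fun_prop)
  unfold planePhase planeCoord
  fun_prop

/-- Action and angle variables determine a generic state. -/
theorem eq_of_phases_eq {p q : PosVel n} (hp : ‖(p.1 : E n)‖ < 1) (hq : ‖(q.1 : E n)‖ < 1)
    (hp1 : halfChord p < 1) (hh : halfChord p = halfChord q) (hQ : chordPhase p = chordPhase q)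
    (hZ : ∀ j, planePhase j p = planePhase j q) : p = q := by
  have hrange : ∀ r : PosVel n, ‖(r.1 : E n)‖ < 1 →
      0 < halfChord r ∧ 0 < age r ∧ age r < 2 * halfChord r := by
    intro r hr
    have hlt : ‖(r.1 : E n)‖ ^ 2 < 1 := (sq_lt_one_iff₀ (norm_nonneg _)).2 hr
    have hsq := sq_halfChord r
    have h0 : 0 < halfChord r := halfChord_pos fun h => by
      rw [h] at hsq
      nlinarith [sq_nonneg ⟪(r.1 : E n), (r.2 : E n)⟫]
    have hb : |⟪(r.1 : E n), (r.2 : E n)⟫| < halfChord r :=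
      abs_lt_of_sq_lt_sq (by linarith) h0.le
    rw [abs_lt] at hb
    unfold age
    exact ⟨h0, by linarith, by linarith⟩
  obtain ⟨h0, ha1, ha2⟩ := hrange p hp
  obtain ⟨-, hb1, hb2⟩ := hrange q hq
  rw [← hh] at hb2
  have h0c : (halfChord p : ℂ) ≠ 0 := by exact_mod_cast h0.ne'
  -- The phase determines the age modulo `2h`, and both ages lie strictly between `0` and `2h`.
  have hage : age p = age q := by
    rw [chordPhase, chordPhase, ← hh, Complex.exp_eq_exp_iff_exists_int] at hQ
    obtain ⟨k, hk⟩ := hQ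
    have hk' : age p = age q + 2 * k * halfChord p := by
      have hpi : (Real.pi : ℂ) ≠ 0 := by exact_mod_cast Real.pi_ne_zero
      simp only [frequency] at hk
      push_cast at hk
      field_simp at hk
      have : (age p : ℂ) = age q + 2 * k * halfChord p :=
        mul_left_cancel₀ hpi (by linear_combination hk)
      exact_mod_cast this
    have hk0 : k = 0 := by
      have e1 : (k : ℝ) < 1 := by nlinarith
      have e2 : (-1 : ℝ) < k := by nlinarith
      have e1' : k < 1 := by exact_mod_cast e1
      have e2' : -1 < k := by exact_mod_cast e2
      omega
    rw [hk', hk0]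
    simp
  -- As `0 < h < 1`, the real and imaginary parts of `planeCoord` give back the velocity and the
  -- foot of the perpendicular. The age then places the state on its chord.
  have hcoord : ∀ j, (p.2 : E n) j = (q.2 : E n) j ∧
      ((p.1 : E n) - ⟪(p.1 : E n), (p.2 : E n)⟫ • (p.2 : E n)) j =
      ((q.1 : E n) - ⟪(q.1 : E n), (q.2 : E n)⟫ • (q.2 : E n)) j := by
    intro j
    have h := hZ j
    rw [planePhase, planePhase, ← hage, ← hh, mul_right_inj' (Complex.exp_ne_zero _), planeCoord,
      planeCoord, mul_right_inj' h0c] at h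
    have hr : 0 < √(1 - halfChord p ^ 2) := Real.sqrt_pos.2 (by nlinarith)
    have hre := congrArg Complex.re h
    have him := congrArg Complex.im h
    simp only [Complex.add_re, Complex.add_im, Complex.re_ofReal_mul, Complex.im_ofReal_mul,
      Complex.I_mul_re, Complex.I_mul_im, Complex.ofReal_re, Complex.ofReal_im, neg_zero, add_zero,
      mul_zero, zero_add] at hre him
    exact ⟨mul_left_cancel₀ hr.ne' hre, him⟩
  have hv : (p.2 : E n) = q.2 := PiLp.ext fun j => (hcoord j).1
  have hc := PiLp.ext fun j => (hcoord j).2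
  have hi : ⟪(p.1 : E n), (p.2 : E n)⟫ = ⟪(q.1 : E n), (q.2 : E n)⟫ := by
    unfold age at hage
    linarith
  rw [hi, hv] at hc
  exact Prod.ext (Subtype.ext (sub_left_injective hc)) (Subtype.ext hv)

end Angles

/-! ## Invariance of the Liouville measure -/

/-- Rotating an interval by a translation modulo its length preserves the Lebesgue measure. -/
theorem setLIntegral_translate_mod {h : ℝ} (hh : 0 < h) (t : ℝ) (H : ℝ → ENNReal) :
    ∫⁻ τ in Set.Icc (-h) h, H (τ + t - ⌊(τ + h + t) / (2 * h)⌋ * (2 * h)) =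
      ∫⁻ τ in Set.Icc (-h) h, H τ := by
  -- `P` is the periodic extension of `H` from `[-h, h)`, with period `2h`; its integral is the same
  -- over all periods.
  let P : ℝ → ENNReal := fun τ => H (τ - ⌊(τ + h) / (2 * h)⌋ * (2 * h))
  have h2 : 0 < 2 * h := by linarith
  have hper : ∀ (g : AddSubgroup.zmultiples (2 * h)) (τ : ℝ), P (g +ᵥ τ) = P τ := by
    rintro ⟨_, k, rfl⟩ τ
    change P (k • (2 * h) + τ) = P τ
    have hk : ⌊(k • (2 * h) + τ + h) / (2 * h)⌋ = ⌊(τ + h) / (2 * h)⌋ + k := by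
      rw [← Int.floor_add_intCast]
      congr 1
      simp only [zsmul_eq_mul]
      field_simp
      ring
    simp only [P, hk]
    congr 1
    push_cast
    simp only [zsmul_eq_mul]
    ring
  have hfund : ∀ a : ℝ, ∫⁻ τ in Set.Ioc a (a + 2 * h), P τ = ∫⁻ τ in Set.Ico (-h) h, P τ := by
    intro a
    have e := (isAddFundamentalDomain_Ioc h2 a volume).setLIntegral_eq
      (isAddFundamentalDomain_Ioc h2 (-h) volume) P hper
    rw [e, show -h + 2 * h = h by ring]
    exact setLIntegral_congr Ico_ae_eq_Ioc.symm
  have hP : ∫⁻ τ in Set.Ico (-h) h, P τ = ∫⁻ τ in Set.Icc (-h) h, H τ := by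
    rw [setLIntegral_congr (Ico_ae_eq_Icc (μ := volume) (a := -h) (b := h)).symm]
    refine setLIntegral_congr_fun measurableSet_Ico fun τ hτ => ?_
    have : ⌊(τ + h) / (2 * h)⌋ = 0 := by
      rw [Int.floor_eq_zero_iff]
      exact ⟨div_nonneg (by linarith [hτ.1]) h2.le, (div_lt_one h2).2 (by linarith [hτ.2])⟩
    simp [P, this]
  rw [← hP, ← hfund (-h + t),
    setLIntegral_congr (Ioc_ae_eq_Icc (μ := volume) (a := -h) (b := h)).symm]
  have e : ∀ τ : ℝ, H (τ + t - ⌊(τ + h + t) / (2 * h)⌋ * (2 * h)) = P (τ + t) := by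
    intro τ
    simp only [P, add_right_comm τ t h]
  simp_rw [e]
  have hmp := measurePreserving_add_right (volume : Measure ℝ) t
  have := hmp.setLIntegral_comp_preimage_emb (MeasurableEquiv.addRight t).measurableEmbedding P
    (Set.Ioc (-h + t) (-h + t + 2 * h))
  rw [← this]
  congr 2
  ext τ
  simp only [Set.mem_preimage, Set.mem_Ioc]
  constructor <;> rintro ⟨h1, h2⟩ <;> constructor <;> linarith

/-! ### Chord decomposition of the ball and symmetry under linear isometries. -/

section Ball

variable {n : ℕ}

/-- Orthogonal decomposition of the Lebesgue measure along a unit vector. -/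
theorem measurePreserving_smul_add {v : E n} (hv : ‖v‖ = 1) :
    MeasurePreserving (fun q : ℝ × (Submodule.span ℝ {v})ᗮ => q.1 • v + (q.2 : E n))
      (volume.prod volume) volume := by
  let e1 := LinearIsometryEquiv.toSpanUnitSingleton (𝕜 := ℝ) v hv
  have h1 : MeasurePreserving
      (Prod.map e1 (id : (Submodule.span ℝ {v})ᗮ → (Submodule.span ℝ {v})ᗮ))
      (volume.prod volume) (volume.prod volume) :=
    e1.measurePreserving.prod (MeasurePreserving.id volume)
  have h2 := WithLp.volume_preserving_toLp (Submodule.span ℝ {v}) (Submodule.span ℝ {v})ᗮ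
  have h3 := (Submodule.span ℝ {v}).orthogonalDecomposition.symm.measurePreserving
  exact (h3.comp h2).comp h1

/-- The ball is the union of its chords in a given direction. -/
theorem lintegral_closedBall_eq {v : E n} (hv : ‖v‖ = 1) {G : E n → ENNReal} (hG : Measurable G) :
    ∫⁻ x in closedBall 0 1, G x = ∫⁻ c : (Submodule.span ℝ {v})ᗮ, ∫⁻ τ in
      {τ : ℝ | τ ^ 2 ≤ 1 - ‖c‖ ^ 2}, G (τ • v + (c : E n)) := by
  rw [← lintegral_indicator measurableSet_closedBall,
    ← (measurePreserving_smul_add hv).lintegral_comp (hG.indicator measurableSet_closedBall),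
    lintegral_prod_symm]
  · refine lintegral_congr fun c => ?_
    have hs : MeasurableSet {τ : ℝ | τ ^ 2 ≤ 1 - ‖c‖ ^ 2} :=
      (isClosed_le (by fun_prop) (by fun_prop)).measurableSet
    rw [← lintegral_indicator hs]
    refine lintegral_congr fun τ => ?_
    have hc : ⟪(c : E n), v⟫ = 0 :=
      Submodule.inner_left_of_mem_orthogonal (Submodule.mem_span_singleton_self v) c.2
    have hn : ‖τ • v + (c : E n)‖ ^ 2 = ‖c‖ ^ 2 + τ ^ 2 := by
      rw [add_comm, norm_add_smul_sq hv, hc]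
      simp
    have hmem : τ • v + (c : E n) ∈ closedBall (0 : E n) 1 ↔ τ ∈ {τ : ℝ | τ ^ 2 ≤ 1 - ‖c‖ ^ 2} := by
      rw [mem_closedBall_zero_iff, ← sq_le_one_iff₀ (norm_nonneg _), hn, Set.mem_ofPred_eq]
      constructor <;> intro h <;> linarith
    by_cases h : τ ∈ {τ : ℝ | τ ^ 2 ≤ 1 - ‖c‖ ^ 2}
    · rw [Set.indicator_of_mem h, Set.indicator_of_mem (hmem.2 h)]
    · rw [Set.indicator_of_notMem h, Set.indicator_of_notMem (mt hmem.1 h)]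
  · exact ((hG.indicator (measurableSet_closedBall (x := 0) (ε := 1))).comp
      (measurePreserving_smul_add hv).measurable).aemeasurable

/-- Action of the linear isometries on the states. -/
noncomputable def rotate (k : E n ≃ₗᵢ[ℝ] E n) (p : PosVel n) : PosVel n :=
  (⟨k p.1, by
    rw [mem_closedBall_zero_iff, k.norm_map]; exact mem_closedBall_zero_iff.1 p.1.2⟩,
  ⟨k p.2, by rw [mem_sphere_zero_iff_norm, k.norm_map]; exact norm_vel p⟩)

theorem rotate_rotate (k l : E n ≃ₗᵢ[ℝ] E n) (p : PosVel n) :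
    rotate k (rotate l p) = rotate (l.trans k) p := rfl

theorem reflect_map (k : E n ≃ₗᵢ[ℝ] E n) (x v : E n) : reflect (k x) (k v) = k (reflect x v) := by
  simp [reflect]

/-- Action of the linear isometries on the states just after a collision. -/
noncomputable def rotateInward (k : E n ≃ₗᵢ[ℝ] E n) (a : Inward n) : Inward n :=
  ⟨(k a.1.1, k a.1.2), by simpa using a.2⟩

theorem chord_rotateInward (k : E n ≃ₗᵢ[ℝ] E n) (a : Inward n) :
    chord (rotateInward k a) = chord a := by
  simp [chord, rotateInward]

theorem nextCollision_rotateInward (k : E n ≃ₗᵢ[ℝ] E n) (a : Inward n) :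
    nextCollision (rotateInward k a) = rotateInward k (nextCollision a) := by
  apply Subtype.ext
  simp only [nextCollision, chord_rotateInward]
  simp only [rotateInward, map_add, map_smul, ← reflect_map]

theorem prevCollision_rotateInward (k : E n ≃ₗᵢ[ℝ] E n) (a : Inward n) :
    prevCollision (rotateInward k a) = rotateInward k (prevCollision a) := by
  apply Subtype.ext
  simp only [prevCollision, chord_rotateInward]
  simp only [rotateInward, map_sub, map_smul, ← reflect_map]

theorem billiardMap_zpow_rotateInward (k : E n ≃ₗᵢ[ℝ] E n) (m : ℤ) (a : Inward n) :
    (billiardMap n ^ m) (rotateInward k a) = rotateInward k ((billiardMap n ^ m) a) := by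
  induction m using Int.induction_on with
  | zero => simp
  | succ m ih =>
    rw [add_comm (m : ℤ) 1, zpow_add, zpow_one, Equiv.Perm.mul_apply, Equiv.Perm.mul_apply, ih]
    exact nextCollision_rotateInward k _
  | pred m ih =>
    rw [sub_eq_neg_add, zpow_add, zpow_neg_one, Equiv.Perm.mul_apply, Equiv.Perm.mul_apply, ih]
    exact prevCollision_rotateInward k _

theorem afterCollision_rotateInward (k : E n ≃ₗᵢ[ℝ] E n) (a : Inward n) (u : ℝ) :
    afterCollision (rotateInward k a) u = rotate k (afterCollision a u) := by
  refine Prod.ext (Subtype.ext ?_) (Subtype.ext ?_)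
  · simp only [afterCollision, chord_rotateInward, billiardMap_zpow_rotateInward]
    simp [rotateInward, rotate]
  · simp only [afterCollision, chord_rotateInward, billiardMap_zpow_rotateInward]
    simp [rotateInward, rotate]

theorem halfChord_rotate (k : E n ≃ₗᵢ[ℝ] E n) (p : PosVel n) :
    halfChord (rotate k p) = halfChord p := by
  simp [halfChord, rotate]

theorem age_rotate (k : E n ≃ₗᵢ[ℝ] E n) (p : PosVel n) : age (rotate k p) = age p := by
  rw [age, age, halfChord_rotate]
  simp [rotate]

theorem evolve_rotate (k : E n ≃ₗᵢ[ℝ] E n) (t : ℝ) (p : PosVel n) :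
    evolve t (rotate k p) = rotate k (evolve t p) := by
  have hr := halfChord_rotate k p
  by_cases h : halfChord p = 0
  · rw [evolve_of_eq h, evolve_of_eq (hr.trans h)]
    refine Prod.ext (Subtype.ext ?_) (Subtype.ext ?_) <;> simp [glide, rotate]
  · have hl : lastCollision (rotate k p) (hr ▸ h) = rotateInward k (lastCollision p h) := by
      apply Subtype.ext
      simp only [lastCollision, age_rotate]
      simp [rotate, rotateInward]
    rw [evolve_of_ne h, evolve_of_ne (hr ▸ h), hl, age_rotate, afterCollision_rotateInward]

/-- Two states with the same half-chord and age differ by a linear isometry. -/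
theorem exists_rotate_eq {p q : PosVel n} (hh : halfChord p = halfChord q) (ha : age p = age q) :
    ∃ k : E n ≃ₗᵢ[ℝ] E n, rotate k p = q := by
  have hi : ⟪(p.1 : E n), (p.2 : E n)⟫ = ⟪(q.1 : E n), (q.2 : E n)⟫ := by
    unfold age at ha
    linarith
  have hv : ‖(p.2 : E n)‖ = ‖(q.2 : E n)‖ := by rw [norm_vel, norm_vel]
  -- `R1` carries the first velocity to the second. `R2` then matches the feet of the
  -- perpendiculars, which have equal norm, and fixes the velocity because both feet are orthogonal
  -- to it.
  let R1 := (Submodule.span ℝ {(p.2 : E n) - q.2})ᗮ.reflection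
  have hR1 : R1 (p.2 : E n) = q.2 := Submodule.reflection_sub hv
  let cp := R1 ((p.1 : E n) - ⟪(p.1 : E n), (p.2 : E n)⟫ • (p.2 : E n))
  let cq := (q.1 : E n) - ⟪(q.1 : E n), (q.2 : E n)⟫ • (q.2 : E n)
  have hc : ‖cp‖ = ‖cq‖ := by
    rw [← sq_eq_sq₀ (norm_nonneg _) (norm_nonneg _), R1.norm_map, norm_offset_sq, norm_offset_sq,
      hh]
  have horth : ∀ r : PosVel n,
      ⟪(r.1 : E n) - ⟪(r.1 : E n), (r.2 : E n)⟫ • (r.2 : E n), (r.2 : E n)⟫ = 0 := by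
    intro r
    rw [sub_eq_add_neg, ← neg_smul, inner_add_smul (norm_vel r), add_neg_cancel]
  let R2 := (Submodule.span ℝ {cp - cq})ᗮ.reflection
  have hR2 : R2 cp = cq := Submodule.reflection_sub hc
  have hR2v : R2 (q.2 : E n) = q.2 := by
    apply Submodule.reflection_mem_subspace_eq_self
    rw [Submodule.mem_orthogonal_singleton_iff_inner_right, inner_sub_left, horth q, ← hR1,
      LinearIsometryEquiv.inner_map_map, horth p, sub_zero]
  have h2 : R2 (R1 (p.2 : E n)) = q.2 := by rw [hR1, hR2v]
  refine ⟨R1.trans R2, Prod.ext (Subtype.ext ?_) (Subtype.ext h2)⟩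
  change R2 (R1 (p.1 : E n)) = q.1
  have e : (p.1 : E n) = ((p.1 : E n) - ⟪(p.1 : E n), (p.2 : E n)⟫ • (p.2 : E n)) +
      ⟪(p.1 : E n), (p.2 : E n)⟫ • (p.2 : E n) := by abel
  have hsum : R2 cp + ⟪(p.1 : E n), (p.2 : E n)⟫ • R2 (R1 (p.2 : E n)) = q.1 := by
    rw [hR2, h2, hi]
    exact sub_add_cancel _ _
  rw [e, map_add, map_add, map_smul, map_smul]
  exact hsum

/-- The Lebesgue measure of the ball times the surface measure of the sphere. -/
noncomputable def stateMeasure (n : ℕ) : Measure (PosVel n) :=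
  (Measure.comap Subtype.val (volume : Measure (E n))).prod (volume : Measure (E n)).toSphere

instance : IsFiniteMeasure
    (Measure.comap Subtype.val (volume : Measure (E n)) : Measure (closedBall (0 : E n) 1)) := by
  constructor
  rw [comap_subtype_coe_apply measurableSet_closedBall]
  rw [Set.image_univ, Subtype.range_coe]
  exact measure_closedBall_lt_top

instance : IsFiniteMeasure (stateMeasure n) := by
  unfold stateMeasure
  infer_instance

-- Both factors inherit their invariance from the Lebesgue measure: the ball by restriction, and the
-- sphere because `toSphere` measures a set through the volume of the cone over it.
open scoped Pointwise in
theorem measurePreserving_rotate (k : E n ≃ₗᵢ[ℝ] E n) :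
    MeasurePreserving (rotate k) (stateMeasure n) (stateMeasure n) := by
  have hcont : Continuous (rotate k) := by
    unfold rotate
    fun_prop
  let kb : closedBall (0 : E n) 1 → closedBall (0 : E n) 1 := fun x =>
    ⟨k x, by rw [mem_closedBall_zero_iff, k.norm_map]; exact mem_closedBall_zero_iff.1 x.2⟩
  let ks : sphere (0 : E n) 1 → sphere (0 : E n) 1 := fun x =>
    ⟨k x, by rw [mem_sphere_zero_iff_norm, k.norm_map]; exact mem_sphere_zero_iff_norm.1 x.2⟩
  have hb : MeasurePreserving kb (Measure.comap Subtype.val (volume : Measure (E n)))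
      (Measure.comap Subtype.val (volume : Measure (E n))) := by
    have hm : Measurable kb := Continuous.measurable (by fun_prop)
    refine ⟨hm, Measure.ext fun s hs => ?_⟩
    rw [Measure.map_apply hm hs, comap_subtype_coe_apply measurableSet_closedBall,
      comap_subtype_coe_apply measurableSet_closedBall]
    have himage : Subtype.val '' (kb ⁻¹' s) = k ⁻¹' (Subtype.val '' s) := by
      ext x
      constructor
      · rintro ⟨y, hy, rfl⟩
        exact ⟨kb y, hy, rfl⟩
      · rintro ⟨y, hy, hyx⟩
        have hx : x ∈ closedBall (0 : E n) 1 := by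
          rw [mem_closedBall_zero_iff, ← k.norm_map, ← hyx]
          exact mem_closedBall_zero_iff.1 y.2
        refine ⟨⟨x, hx⟩, ?_, rfl⟩
        have : kb ⟨x, hx⟩ = y := Subtype.ext hyx.symm
        rwa [Set.mem_preimage, this]
    rw [himage]
    exact k.measurePreserving.measure_preimage
      (measurableSet_closedBall.subtype_image hs).nullMeasurableSet
  have hs : MeasurePreserving ks (volume : Measure (E n)).toSphere
      (volume : Measure (E n)).toSphere := by
    have hm : Measurable ks := Continuous.measurable (by fun_prop)
    refine ⟨hm, Measure.ext fun s hs => ?_⟩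
    rw [Measure.map_apply hm hs, Measure.toSphere_apply' _ hs, Measure.toSphere_apply' _ (hm hs)]
    congr 1
    have himage : Set.Ioo (0 : ℝ) 1 • (Subtype.val '' (ks ⁻¹' s)) =
        k ⁻¹' (Set.Ioo (0 : ℝ) 1 • (Subtype.val '' s)) := by
      ext x
      constructor
      · rintro ⟨r, hr, _, ⟨y, hy, rfl⟩, rfl⟩
        exact ⟨r, hr, _, ⟨ks y, hy, rfl⟩, by simp [ks]⟩
      · rintro ⟨r, hr, _, ⟨y, hy, rfl⟩, hyx⟩
        have hy1 : k.symm y ∈ sphere (0 : E n) 1 := by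
          rw [mem_sphere_zero_iff_norm, k.symm.norm_map]
          exact mem_sphere_zero_iff_norm.1 y.2
        have hks : ks ⟨k.symm y, hy1⟩ = y := Subtype.ext (by simp [ks])
        refine ⟨r, hr, k.symm y, ⟨⟨k.symm y, hy1⟩, ?_, rfl⟩, ?_⟩
        · rwa [Set.mem_preimage, hks]
        · apply k.injective
          rw [← hyx]
          simp
    rw [himage]
    exact k.measurePreserving.measure_preimage_emb k.toHomeomorph.measurableEmbedding _
  exact hb.prod hs

end Ball

/-! ### The flow preserves the measure: rotation invariant functions, then averaging. -/

section Preservation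

variable {n : ℕ}

theorem halfChord_smul_add {v : E n} {c : (Submodule.span ℝ {v})ᗮ} {τ : ℝ} {p : PosVel n}
    (h1 : (p.1 : E n) = τ • v + (c : E n)) (h2 : (p.2 : E n) = v) :
    halfChord p = √(1 - ‖c‖ ^ 2) ∧ ⟪(p.1 : E n), (p.2 : E n)⟫ = τ := by
  have hv : ‖v‖ = 1 := h2 ▸ norm_vel p
  have hc : ⟪(c : E n), v⟫ = 0 :=
    Submodule.inner_left_of_mem_orthogonal (Submodule.mem_span_singleton_self v) c.2
  have hi : ⟪(p.1 : E n), (p.2 : E n)⟫ = τ := by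
    rw [h1, h2, add_comm, inner_add_smul hv, hc, zero_add]
  refine ⟨?_, hi⟩
  rw [halfChord, hi, h1, add_comm (τ • v), norm_add_smul_sq hv, hc]
  congr 1
  simp only [Submodule.coe_norm]
  ring

theorem smul_add_mem_closedBall {v : E n} (hv : ‖v‖ = 1) {c : (Submodule.span ℝ {v})ᗮ} {τ : ℝ} :
    τ • v + (c : E n) ∈ closedBall (0 : E n) 1 ↔ τ ^ 2 ≤ 1 - ‖c‖ ^ 2 := by
  have hc : ⟪(c : E n), v⟫ = 0 :=
    Submodule.inner_left_of_mem_orthogonal (Submodule.mem_span_singleton_self v) c.2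
  rw [mem_closedBall_zero_iff, ← sq_le_one_iff₀ (norm_nonneg _), add_comm, norm_add_smul_sq hv, hc,
    Submodule.coe_norm]
  constructor <;> intro h <;> linarith

/-- For a fixed velocity, the flow preserves the integral of the rotation invariant functions. -/
theorem lintegral_evolve_of_rotate_eq {F : PosVel n → ENNReal} (hF : Measurable F)
    (hrot : ∀ k p, F (rotate k p) = F p) (t : ℝ) (v : sphere (0 : E n) 1) :
    ∫⁻ x, F (evolve t (x, v)) ∂(Measure.comap Subtype.val (volume : Measure (E n))) =
      ∫⁻ x, F (x, v) ∂(Measure.comap Subtype.val (volume : Measure (E n))) := by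
  have hv : ‖(v : E n)‖ = 1 := norm_eq_of_mem_sphere v
  have hemb : MeasurableEmbedding (Subtype.val : closedBall (0 : E n) 1 → E n) :=
    MeasurableEmbedding.subtype_coe measurableSet_closedBall
  have hmk : Measurable fun x : closedBall (0 : E n) 1 => ((x, v) : PosVel n) :=
    measurable_id.prodMk measurable_const
  -- Both integrands are extended from the ball to the whole space, so that the decomposition into
  -- chords applies.
  obtain ⟨G, hG, hGe⟩ := hemb.exists_measurable_extend (hF.comp hmk) fun _ => inferInstance
  obtain ⟨G', hG', hGe'⟩ := hemb.exists_measurable_extend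
    (hF.comp ((measurable_evolve t).comp hmk)) fun _ => inferInstance
  have e1 : ∀ x : closedBall (0 : E n) 1, F (x, v) = G x := fun x => (congrFun hGe x).symm
  have e2 : ∀ x : closedBall (0 : E n) 1, F (evolve t (x, v)) = G' x :=
    fun x => (congrFun hGe' x).symm
  simp_rw [e1, e2]
  rw [lintegral_subtype_comap measurableSet_closedBall,
    lintegral_subtype_comap measurableSet_closedBall, lintegral_closedBall_eq hv hG,
    lintegral_closedBall_eq hv hG']
  refine lintegral_congr fun c => ?_
  rcases lt_or_ge ‖c‖ 1 with hc | hc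
  swap
  · have hz : volume {τ : ℝ | τ ^ 2 ≤ 1 - ‖c‖ ^ 2} = 0 := by
      refine measure_mono_null (t := {0}) (fun τ hτ => ?_) (by simp)
      have hτ' : τ ^ 2 ≤ 1 - ‖c‖ ^ 2 := hτ
      have : τ ^ 2 = 0 := by nlinarith [sq_nonneg τ]
      simpa using this
    rw [setLIntegral_measure_zero _ _ hz, setLIntegral_measure_zero _ _ hz]
  have hpos : 0 < 1 - ‖c‖ ^ 2 := by nlinarith [norm_nonneg c]
  have hh : 0 < √(1 - ‖c‖ ^ 2) := Real.sqrt_pos.2 hpos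
  have hset : {τ : ℝ | τ ^ 2 ≤ 1 - ‖c‖ ^ 2} =
      Set.Icc (-√(1 - ‖c‖ ^ 2)) (√(1 - ‖c‖ ^ 2)) := by
    ext τ
    exact Real.sq_le hpos.le
  rw [hset, ← setLIntegral_translate_mod hh t fun τ => G (τ • (v : E n) + (c : E n))]
  refine setLIntegral_congr_fun measurableSet_Icc fun τ hτ => ?_
  set h := √(1 - ‖c‖ ^ 2) with hdef
  have hball : ∀ s ∈ Set.Icc (-h) h, s • (v : E n) + (c : E n) ∈ closedBall (0 : E n) 1 := by
    intro s hs
    rw [smul_add_mem_closedBall hv]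
    have : s ∈ {τ : ℝ | τ ^ 2 ≤ 1 - ‖c‖ ^ 2} := by rwa [hset]
    exact this
  set s := τ + t - ⌊(τ + h + t) / (2 * h)⌋ * (2 * h) with hs
  have hsI : s ∈ Set.Icc (-h) h := by
    have f1 := (le_div_iff₀ (by linarith : 0 < 2 * h)).1 (Int.floor_le ((τ + h + t) / (2 * h)))
    have f2 := (div_lt_iff₀ (by linarith : 0 < 2 * h)).1
      (Int.lt_floor_add_one ((τ + h + t) / (2 * h)))
    constructor <;> rw [hs] <;> linarith
  let p : PosVel n := (⟨τ • (v : E n) + (c : E n), hball τ hτ⟩, v)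
  let q : PosVel n := (⟨s • (v : E n) + (c : E n), hball s hsI⟩, v)
  obtain ⟨hp1, hp2⟩ := halfChord_smul_add (p := p) (c := c) (τ := τ) rfl rfl
  obtain ⟨hq1, hq2⟩ := halfChord_smul_add (p := q) (c := c) (τ := s) rfl rfl
  rw [← hdef] at hp1 hq1
  have hp0 : halfChord p ≠ 0 := hp1 ▸ hh.ne'
  have hage : age (evolve t p) = age q := by
    have hap : age p = τ + h := by rw [age, hp1, hp2]
    have haq : age q = s + h := by rw [age, hq1, hq2]
    rw [age_evolve hp0, hap, haq, hp1, hs]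
    ring
  -- The evolved state generally has another velocity than `q`, but the same half-chord and age, so
  -- a rotation invariant function takes the same value at both.
  obtain ⟨k, hk⟩ := exists_rotate_eq (p := evolve t p) (q := q)
    (by rw [halfChord_evolve, hp1, hq1]) hage
  calc G' (τ • (v : E n) + (c : E n)) = F (evolve t p) := (e2 ⟨_, hball τ hτ⟩).symm
    _ = F q := by rw [← hk, hrot]
    _ = G (s • (v : E n) + (c : E n)) := e1 ⟨_, hball s hsI⟩

theorem lintegral_evolve_of_rotate_eq' {F : PosVel n → ENNReal} (hF : Measurable F)
    (hrot : ∀ k p, F (rotate k p) = F p) (t : ℝ) :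
    ∫⁻ p, F (evolve t p) ∂stateMeasure n = ∫⁻ p, F p ∂stateMeasure n := by
  have hFt : Measurable fun p => F (evolve t p) := hF.comp (measurable_evolve t)
  rw [stateMeasure, lintegral_prod_symm _ hFt.aemeasurable,
    lintegral_prod_symm _ hF.aemeasurable]
  exact lintegral_congr fun v => lintegral_evolve_of_rotate_eq hF hrot t v

instance : ContinuousStar (E n →L[ℝ] E n) := ⟨ContinuousLinearMap.adjoint.continuous⟩

instance : IsTopologicalGroup (unitary (E n →L[ℝ] E n)) := inferInstance

/-- The orthogonal group is closed and bounded in a finite-dimensional space. Compactness provides a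
Haar measure of total mass one over which to average. -/
instance : CompactSpace (unitary (E n →L[ℝ] E n)) := by
  suffices h : IsCompact (unitary (E n →L[ℝ] E n) : Set (E n →L[ℝ] E n)) from
    isCompact_iff_compactSpace.1 h
  have : ProperSpace (E n →L[ℝ] E n) := FiniteDimensional.proper ℝ _
  refine Metric.isCompact_of_isClosed_isBounded isClosed_unitary ?_
  refine (isBounded_closedBall (x := (0 : E n →L[ℝ] E n)) (r := 1)).subset fun u hu => ?_
  rw [mem_closedBall_zero_iff]
  refine ContinuousLinearMap.opNorm_le_bound _ zero_le_one fun x => ?_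
  rw [one_mul]
  exact (Unitary.norm_map ⟨u, hu⟩ x).le

/-- The linear isometry attached to the inverse of an element of the orthogonal group. -/
noncomputable def invIsometry (u : unitary (E n →L[ℝ] E n)) : E n ≃ₗᵢ[ℝ] E n :=
  Unitary.linearIsometryEquiv u⁻¹

theorem measurable_rotate_invIsometry :
    Measurable fun q : unitary (E n →L[ℝ] E n) × PosVel n => rotate (invIsometry q.1) q.2 := by
  refine Continuous.measurable ?_
  have h1 : Continuous fun q : unitary (E n →L[ℝ] E n) × PosVel n =>
      ((q.1⁻¹ : unitary (E n →L[ℝ] E n)) : E n →L[ℝ] E n) :=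
    continuous_subtype_val.comp continuous_fst.inv
  have h2 : Continuous fun q : unitary (E n →L[ℝ] E n) × PosVel n =>
      ((q.1⁻¹ : unitary (E n →L[ℝ] E n)) : E n →L[ℝ] E n) (q.2.1 : E n) :=
    h1.clm_apply (by fun_prop)
  have h3 : Continuous fun q : unitary (E n →L[ℝ] E n) × PosVel n =>
      ((q.1⁻¹ : unitary (E n →L[ℝ] E n)) : E n →L[ℝ] E n) (q.2.2 : E n) :=
    h1.clm_apply (by fun_prop)
  exact (h2.subtype_mk _).prodMk (h3.subtype_mk _)

/-- Averaging over the orthogonal group reduces the invariance of the measure to the invariance of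
the integrals of the rotation invariant functions. -/
theorem lintegral_evolve {F : PosVel n → ENNReal} (hF : Measurable F) (t : ℝ) :
    ∫⁻ p, F (evolve t p) ∂stateMeasure n = ∫⁻ p, F p ∂stateMeasure n := by
  let m : Measure (unitary (E n →L[ℝ] E n)) := Measure.haarMeasure ⊤
  have hm1 : m Set.univ = 1 := by
    simpa using! Measure.haarMeasure_self (K₀ := (⊤ : TopologicalSpace.PositiveCompacts
      (unitary (E n →L[ℝ] E n))))
  have : IsFiniteMeasure m := ⟨by simp [hm1]⟩
  let A : PosVel n → ENNReal := fun p => ∫⁻ u, F (rotate (invIsometry u) p) ∂m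
  have hjoint := hF.comp (measurable_rotate_invIsometry (n := n))
  have hA : Measurable A := hjoint.lintegral_prod_left'
  have hArot : ∀ k p, A (rotate k p) = A p := by
    intro k p
    let g := Unitary.linearIsometryEquiv.symm k
    -- Thanks to the inverse in `invIsometry`, rotating first by `k` becomes a left translation of
    -- `u`, which the Haar measure does not see.
    have hg : ∀ u, F (rotate (invIsometry u) (rotate k p)) =
        (fun u => F (rotate (invIsometry u) p)) (g⁻¹ * u) := by
      intro u
      have : invIsometry (g⁻¹ * u) = k.trans (invIsometry u) := by
        rw [invIsometry, invIsometry, mul_inv_rev, inv_inv, map_mul]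
        simp only [g, MulEquiv.apply_symm_apply]
        rfl
      simp only [this, rotate_rotate]
    simp only [A, hg]
    exact lintegral_mul_left_eq_self (fun u => F (rotate (invIsometry u) p)) g⁻¹
  -- For `T` commuting with isometries, Tonelli and the rotation invariance of the measure give `F ∘
  -- T` and `A ∘ T` the same integral. This is used for the flow and for the identity.
  have hav : ∀ T : PosVel n → PosVel n, Measurable T → (∀ k p, T (rotate k p) = rotate k (T p)) →
      ∫⁻ p, F (T p) ∂stateMeasure n = ∫⁻ p, A (T p) ∂stateMeasure n := by
    intro T hT hTk
    have h1 : ∀ u : unitary (E n →L[ℝ] E n),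
        ∫⁻ p, F (rotate (invIsometry u) (T p)) ∂stateMeasure n =
          ∫⁻ p, F (T p) ∂stateMeasure n := by
      intro u
      simp_rw [← hTk]
      exact (measurePreserving_rotate (invIsometry u)).lintegral_comp (hF.comp hT)
    have h2 : ∫⁻ u, ∫⁻ p, F (rotate (invIsometry u) (T p)) ∂stateMeasure n ∂m =
        ∫⁻ p, F (T p) ∂stateMeasure n := by
      simp_rw [h1]
      rw [lintegral_const, hm1, mul_one]
    rw [← h2, lintegral_lintegral_swap]
    exact (hjoint.comp (measurable_fst.prodMk (hT.comp measurable_snd))).aemeasurable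
  rw [hav _ (measurable_evolve t) fun k p => evolve_rotate k t p,
    lintegral_evolve_of_rotate_eq' hA hArot t]
  exact (hav id measurable_id fun _ _ => rfl).symm

theorem measurePreserving_evolve (t : ℝ) :
    MeasurePreserving (evolve t) (stateMeasure n) (stateMeasure n) := by
  refine ⟨measurable_evolve t, Measure.ext fun s hs => ?_⟩
  have h := lintegral_evolve (n := n) (measurable_one.indicator hs) t
  have e : ∀ p : PosVel n, s.indicator (1 : PosVel n → ENNReal) (evolve t p) =
      (evolve t ⁻¹' s).indicator 1 p := fun p => rfl
  simp_rw [e] at h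
  rwa [lintegral_indicator_one hs, lintegral_indicator_one (measurable_evolve t hs),
    ← Measure.map_apply (measurable_evolve t) hs] at h

/-! ### Passage to the Liouville measure on the phase space. -/

theorem liouville_eq : liouville n = (stateMeasure n Set.univ)⁻¹ •
    (stateMeasure n).map (Quotient.mk (collisionSetoid n)) := rfl

theorem stateMeasure_univ_ne_zero (hn : 2 ≤ n) : stateMeasure n Set.univ ≠ 0 := by
  have : Nonempty (Fin n) := ⟨⟨0, by omega⟩⟩
  have : Nontrivial (E n) := inferInstance
  rw [stateMeasure, ← Set.univ_prod_univ, Measure.prod_prod]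
  refine mul_ne_zero ?_ ?_
  · rw [comap_subtype_coe_apply measurableSet_closedBall, Set.image_univ, Subtype.range_coe]
    exact (measure_closedBall_pos volume (0 : E n) one_pos).ne'
  · rw [Ne, Measure.measure_univ_eq_zero]
    exact Measure.toSphere_ne_zero _

theorem isProbabilityPreservingFlow_billiardFlow (hn : 2 ≤ n) :
    IsProbabilityPreservingFlow (liouville n) (billiardFlow n) where
  isProbabilityMeasure := by
    constructor
    rw [liouville_eq, Measure.smul_apply, Measure.map_apply measurable_mk .univ, Set.preimage_univ,
      smul_eq_mul]
    exact ENNReal.inv_mul_cancel (stateMeasure_univ_ne_zero hn) (measure_ne_top _ _)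
  map_zero := billiardFlow_zero
  map_add := billiardFlow_add
  measurePreserving t := by
    refine MeasurePreserving.smul_measure ⟨measurable_billiardFlow t, ?_⟩ _
    change Measure.map _ ((stateMeasure n).map _) = (stateMeasure n).map _
    rw [Measure.map_map (measurable_billiardFlow t) measurable_mk]
    have : billiardFlow n t ∘ Quotient.mk (collisionSetoid n) =
        Quotient.mk (collisionSetoid n) ∘ evolve t := rfl
    rw [this, ← Measure.map_map measurable_mk (measurable_evolve t),
      (measurePreserving_evolve t).map_eq]

theorem ae_liouville_of_ae_stateMeasure {P : PhaseSpace n → Prop}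
    (hP : MeasurableSet {ω | P ω})
    (h : ∀ᵐ p ∂stateMeasure n, P (Quotient.mk (collisionSetoid n) p)) :
    ∀ᵐ ω ∂liouville n, P ω := by
  rw [liouville_eq]
  exact Measure.ae_smul_measure ((ae_map_iff measurable_mk.aemeasurable hP).2 h) _

end Preservation

/-! ## Absolute continuity of the frequencies -/

/-- The norm has an absolutely continuous law under the Lebesgue measure. -/
theorem ae_norm_notMem {F : Type*} [NormedAddCommGroup F] [InnerProductSpace ℝ F]
    [FiniteDimensional ℝ F] [Nontrivial F] [MeasurableSpace F] [BorelSpace F] {N : Set ℝ}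
    (hN : volume N = 0) : ∀ᵐ c : F, ‖c‖ ∉ N := by
  -- In polar coordinates the law of the norm has a density proportional to `y ^ (dim - 1)`.
  have hz : (fun y : ℝ => y ^ (Module.finrank ℝ F - 1) • N.indicator (1 : ℝ → ℝ) y)
      =ᵐ[volume.restrict (Set.Ioi 0)] 0 := by
    refine ae_restrict_of_ae ?_
    filter_upwards [measure_eq_zero_iff_ae_notMem.1 hN] with y hy
    simp [hy]
  have hint : Integrable (fun c : F => N.indicator (1 : ℝ → ℝ) ‖c‖) volume := by
    rw [integrable_fun_norm_addHaar (μ := (volume : Measure F))]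
    exact (integrable_zero _ _ _).congr hz.symm
  have h0 : ∫ c : F, N.indicator (1 : ℝ → ℝ) ‖c‖ = 0 := by
    rw [integral_fun_norm_addHaar (volume : Measure F), integral_congr_ae hz]
    simp
  rw [integral_eq_zero_iff_of_nonneg (fun c => Set.indicator_nonneg (by simp) _) hint] at h0
  filter_upwards [h0] with c hc hcN
  simp [hcN] at hc

/-- The derivative of the frequency is `f h / h²`, with `f` as below, so it suffices that the zeros
of `f` form a null set. If `m = 0`, `f` is the nonzero constant `-k π`; otherwise `f' = m h² / √(1 -
h²)³` does not vanish on `(0, 1)`. Hence `volume_inter_preimage_eq_zero` is used twice, for `f` and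
for the frequency. -/
theorem volume_frequency_preimage {k m : ℤ} (hkm : ¬(k = 0 ∧ m = 0)) {N : Set ℝ}
    (hN : volume N = 0) : volume (Set.Ioo 0 1 ∩ frequency k m ⁻¹' N) = 0 := by
  have hr : ∀ h ∈ Set.Ioo (0 : ℝ) 1, 0 < √(1 - h ^ 2) := fun h hh =>
    Real.sqrt_pos.2 (by nlinarith [hh.1, hh.2])
  have harcsin : ∀ h ∈ Set.Ioo (0 : ℝ) 1,
      HasStrictDerivAt Real.arcsin (1 / √(1 - h ^ 2)) h := fun h hh =>
    Real.hasStrictDerivAt_arcsin (by linarith [hh.1]) hh.2.ne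
  let f : ℝ → ℝ := fun h => m * (h / √(1 - h ^ 2) - Real.arcsin h) - k * Real.pi
  have hfm : Measurable f := by
    have := Real.measurable_arcsin
    fun_prop
  have hZ : volume (Set.Ioo 0 1 ∩ f ⁻¹' {0}) = 0 := by
    by_cases hm : m = 0
    · have hk : k ≠ 0 := fun hk => hkm ⟨hk, hm⟩
      have : f ⁻¹' {0} = ∅ := by
        ext h
        simp [f, hm, hk, Real.pi_ne_zero]
      simp [this]
    · refine volume_inter_preimage_eq_zero (f' := fun h => m * (h ^ 2 / √(1 - h ^ 2) ^ 3))
        measurableSet_Ioo hfm ?_ ?_ (by simp)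
      · intro h hh
        have hr0 := hr h hh
        have h1 : HasStrictDerivAt (fun h : ℝ => 1 - h ^ 2) (-(2 * h)) h := by
          simpa using ((hasStrictDerivAt_id h).pow 2).const_sub 1
        have h2 := h1.sqrt (by nlinarith [hh.1, hh.2])
        have h3 : HasStrictDerivAt f _ h :=
          ((((hasStrictDerivAt_id h).div h2 hr0.ne').sub (harcsin h hh)).const_mul
            (m : ℝ)).sub_const (k * Real.pi)
        convert h3 using 1
        simp only [id]
        field_simp
        ring
      · intro h hh
        have hr0 := hr h hh
        have := hh.1
        have hm' : (m : ℝ) ≠ 0 := by exact_mod_cast hm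
        positivity
  have hmain : volume ((Set.Ioo 0 1 \ (f ⁻¹' {0})) ∩ frequency k m ⁻¹' N) = 0 := by
    refine volume_inter_preimage_eq_zero (f' := fun h => f h / h ^ 2)
      (measurableSet_Ioo.diff (hfm (measurableSet_singleton 0))) (measurable_frequency k m) ?_ ?_ hN
    · rintro h ⟨hh, -⟩
      have h1 := (((harcsin h hh).const_mul (m : ℝ)).const_add (k * Real.pi)).div
        (hasStrictDerivAt_id h) hh.1.ne'
      refine h1.congr_deriv ?_
      simp only [id, f]
      ring
    · rintro h ⟨hh, h0⟩
      exact div_ne_zero h0 (pow_ne_zero 2 hh.1.ne')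
  refine measure_mono_null ?_ (measure_union_null hmain hZ)
  rintro h ⟨hh, hhN⟩
  by_cases h0 : f h = 0
  · exact Or.inr ⟨hh, h0⟩
  · exact Or.inl ⟨⟨hh, h0⟩, hhN⟩

section Law

variable {n : ℕ}

/-- This is where the dimension matters: for `n = 1` every half-chord equals `1`, and its law is an
atom. -/
theorem nontrivial_orthogonal (hn : 2 ≤ n) (v : E n) :
    Nontrivial (Submodule.span ℝ {v})ᗮ := by
  refine Module.nontrivial_of_finrank_pos (R := ℝ) ?_
  have h1 := Submodule.finrank_add_finrank_orthogonal (Submodule.span ℝ {v})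
  have h2 := finrank_span_le_card (R := ℝ) ({v} : Set (E n))
  rw [Set.toFinset_singleton, Finset.card_singleton] at h2
  rw [finrank_euclideanSpace_fin] at h1
  omega

/-- The law of the half-chord is absolutely continuous. -/
theorem stateMeasure_map_halfChord (hn : 2 ≤ n) :
    (stateMeasure n).map halfChord ≪ volume := by
  refine Measure.AbsolutelyContinuous.mk fun N hNm hN => ?_
  rw [Measure.map_apply measurable_halfChord hNm, ← lintegral_indicator_one
    (measurable_halfChord hNm), stateMeasure, lintegral_prod_symm _
    (measurable_one.indicator (measurable_halfChord hNm)).aemeasurable]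
  rw [lintegral_eq_zero_iff']
  swap
  · exact (measurable_one.indicator (measurable_halfChord hNm)).lintegral_prod_left'.aemeasurable
  refine Eventually.of_forall fun v => ?_
  have hv : ‖(v : E n)‖ = 1 := norm_eq_of_mem_sphere v
  let G : E n → ENNReal := fun x => N.indicator 1 (√(⟪x, (v : E n)⟫ ^ 2 + (1 - ‖x‖ ^ 2)))
  have hG : Measurable G :=
    (measurable_one.indicator hNm).comp (Continuous.measurable (by fun_prop))
  have e : ∀ x : closedBall (0 : E n) 1,
      (halfChord ⁻¹' N).indicator (1 : PosVel n → ENNReal) (x, v) = G x := fun x => rfl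
  simp_rw [e]
  rw [Pi.zero_apply, lintegral_subtype_comap measurableSet_closedBall,
    lintegral_closedBall_eq hv hG]
  have := nontrivial_orthogonal hn (v : E n)
  -- For a fixed velocity the half-chord is `√(1 - ‖c‖²)`, where `c` is the component of the
  -- position orthogonal to `v`. The set of bad values of `‖c‖` is null, because `r ↦ √(1 - r²)` has
  -- nonzero derivative on `(0, 1)`.
  have hN' : volume ((Set.Ioo 0 1 ∩ (fun r : ℝ => √(1 - r ^ 2)) ⁻¹' N) ∪ {0, 1}) = 0 := by
    refine measure_union_null ?_ ((Set.toFinite _).measure_zero _)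
    refine volume_inter_preimage_eq_zero (f' := fun r => -(2 * r) / (2 * √(1 - r ^ 2)))
      measurableSet_Ioo (by fun_prop) ?_ ?_ hN
    · intro r hr
      have h1 : HasStrictDerivAt (fun r : ℝ => 1 - r ^ 2) (-(2 * r)) r := by
        simpa using ((hasStrictDerivAt_id r).pow 2).const_sub 1
      exact h1.sqrt (by nlinarith [hr.1, hr.2])
    · intro r hr
      have h0 : 0 < √(1 - r ^ 2) := Real.sqrt_pos.2 (by nlinarith [hr.1, hr.2])
      exact div_ne_zero (by linarith [hr.1]) (by positivity)
  rw [← lintegral_zero (μ := (volume : Measure (Submodule.span ℝ {(v : E n)})ᗮ))]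
  refine lintegral_congr_ae ?_
  filter_upwards [ae_norm_notMem (F := (Submodule.span ℝ {(v : E n)})ᗮ) hN'] with c hc
  rw [← lintegral_zero (μ := volume.restrict {τ : ℝ | τ ^ 2 ≤ 1 - ‖c‖ ^ 2})]
  refine setLIntegral_congr_fun (isClosed_le (by fun_prop) (by fun_prop)).measurableSet
    fun τ hτ => ?_
  let p : PosVel n := (⟨τ • (v : E n) + (c : E n), (smul_add_mem_closedBall hv).2 hτ⟩, v)
  have hp : √(⟪τ • (v : E n) + (c : E n), (v : E n)⟫ ^ 2 + (1 - ‖τ • (v : E n) + (c : E n)‖ ^ 2))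
      = √(1 - ‖c‖ ^ 2) := (halfChord_smul_add (p := p) (c := c) (τ := τ) rfl rfl).1
  have hτ' : τ ^ 2 ≤ 1 - ‖c‖ ^ 2 := hτ
  have hc1 : ‖c‖ ≤ 1 := by
    rw [← sq_le_one_iff₀ (norm_nonneg c)]
    nlinarith [sq_nonneg τ]
  simp only [Set.mem_union, Set.mem_inter_iff, Set.mem_Ioo, Set.mem_preimage, Set.mem_insert_iff,
    Set.mem_singleton_iff, not_or, not_and] at hc
  obtain ⟨hcN, hc0, hc1'⟩ := hc
  have := hcN ⟨lt_of_le_of_ne (norm_nonneg c) (Ne.symm hc0), lt_of_le_of_ne hc1 hc1'⟩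
  simp only [G, hp]
  exact Set.indicator_of_notMem this _

theorem ae_halfChord_mem_Ioo (hn : 2 ≤ n) :
    ∀ᵐ p ∂stateMeasure n, halfChord p ∈ Set.Ioo 0 1 := by
  have h : volume ({0, 1} : Set ℝ) = 0 := (Set.toFinite _).measure_zero _
  have h' := stateMeasure_map_halfChord hn h
  rw [Measure.map_apply measurable_halfChord (Set.toFinite _).measurableSet] at h'
  filter_upwards [measure_eq_zero_iff_ae_notMem.1 h'] with p hp
  simp only [Set.mem_preimage, Set.mem_insert_iff, Set.mem_singleton_iff, not_or] at hp
  exact ⟨halfChord_pos hp.1, lt_of_le_of_ne (halfChord_le_one p) hp.2⟩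

theorem ae_norm_lt_one : ∀ᵐ p ∂stateMeasure n, ‖(p.1 : E n)‖ < 1 := by
  have hs : (Subtype.val : closedBall (0 : E n) 1 → E n) '' {x | ‖(x : E n)‖ = 1} ⊆
      sphere 0 1 := by
    rintro _ ⟨x, hx, rfl⟩
    exact mem_sphere_zero_iff_norm.2 hx
  have h0 : (Measure.comap Subtype.val (volume : Measure (E n)))
      {x : closedBall (0 : E n) 1 | ‖(x : E n)‖ = 1} = 0 := by
    rw [comap_subtype_coe_apply measurableSet_closedBall]
    exact measure_mono_null hs (Measure.addHaar_sphere_of_ne_zero _ _ one_ne_zero)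
  have h : stateMeasure n ({x : closedBall (0 : E n) 1 | ‖(x : E n)‖ = 1} ×ˢ Set.univ) = 0 := by
    rw [stateMeasure, Measure.prod_prod, h0, zero_mul]
  filter_upwards [measure_eq_zero_iff_ae_notMem.1 h] with p hp
  refine lt_of_le_of_ne (mem_closedBall_zero_iff.1 p.1.2) fun h1 => hp ⟨h1, trivial⟩

/-! ## The eigenfunctions on the phase space -/

/-- The half-chord of a state of the phase space. -/
noncomputable def phaseHalfChord : PhaseSpace n → ℝ :=
  Quotient.lift halfChord (by
    rintro p q (rfl | rfl)
    · rfl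
    · exact (halfChord_collide p).symm)

theorem measurable_phaseHalfChord : Measurable (phaseHalfChord : PhaseSpace n → ℝ) :=
  measurable_from_quotient.2 measurable_halfChord

theorem liouville_map_frequency (hn : 2 ≤ n) {k m : ℤ} (hkm : ¬(k = 0 ∧ m = 0)) :
    (liouville n).map (fun ω => frequency k m (phaseHalfChord ω)) ≪ volume := by
  have hm : Measurable fun ω : PhaseSpace n => frequency k m (phaseHalfChord ω) :=
    (measurable_frequency k m).comp measurable_phaseHalfChord
  refine Measure.AbsolutelyContinuous.mk fun N hNm hN => ?_
  rw [Measure.map_apply hm hNm, measure_eq_zero_iff_ae_notMem]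
  refine ae_liouville_of_ae_stateMeasure (hm hNm).compl ?_
  have h := stateMeasure_map_halfChord hn (volume_frequency_preimage hkm hN)
  rw [Measure.map_apply measurable_halfChord
    (measurableSet_Ioo.inter (measurable_frequency k m hNm))] at h
  filter_upwards [measure_eq_zero_iff_ae_notMem.1 h, ae_halfChord_mem_Ioo hn] with p hp hp' hpN
  exact hp ⟨hp', hpN⟩

/-- Action and angle variables. -/
noncomputable def actionAngle : Option (Option (Fin n)) → PosVel n → ℂ
  | none => fun p => halfChord p
  | some none => chordPhase
  | some (some j) => planePhase j

theorem exists_actionAngle_evolve (i : Option (Option (Fin n))) : ∃ k m : ℤ, ∀ t p,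
    actionAngle i (evolve t p) =
      Complex.exp (t * frequency k m (halfChord p) * Complex.I) * actionAngle i p := by
  match i with
  | none => exact ⟨0, 0, fun t p => by simp [actionAngle, halfChord_evolve, frequency]⟩
  | some none => exact ⟨1, 0, chordPhase_evolve⟩
  | some (some j) => exact ⟨0, 1, planePhase_evolve j⟩

/-- No computation is needed: `evolve 0` does not distinguish a pair from its collision, and the
eigenfunction relation at time zero says that `evolve 0` leaves the variable unchanged. -/
theorem actionAngle_collide (i : Option (Option (Fin n))) (p : PosVel n) :
    actionAngle i (collide p) = actionAngle i p := by
  obtain ⟨k, m, h⟩ := exists_actionAngle_evolve i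
  have h0 : ∀ q, actionAngle i (evolve 0 q) = actionAngle i q := fun q => by simpa using h 0 q
  rw [← h0 (collide p), evolve_collide, h0]

theorem measurable_actionAngle (i : Option (Option (Fin n))) : Measurable (actionAngle i) := by
  match i with
  | none => exact Complex.measurable_ofReal.comp measurable_halfChord
  | some none => exact measurable_chordPhase
  | some (some j) => exact measurable_planePhase j

theorem norm_actionAngle_le (i : Option (Option (Fin n))) (p : PosVel n) :
    ‖actionAngle i p‖ ≤ 1 := by
  match i with
  | none =>
    change ‖(halfChord p : ℂ)‖ ≤ 1
    rw [Complex.norm_real, Real.norm_of_nonneg (halfChord_nonneg p)]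
    exact halfChord_le_one p
  | some none => exact (norm_chordPhase p).le
  | some (some j) => exact norm_planePhase_le j p

/-- Action and angle variables on the phase space. -/
noncomputable def phaseActionAngle (i : Option (Option (Fin n))) : PhaseSpace n → ℂ :=
  Quotient.lift (actionAngle i) (by
    rintro p q (rfl | rfl)
    · rfl
    · exact (actionAngle_collide i p).symm)

/-- The bounded eigenfunctions of the flow, with a frequency which depends on the half-chord. -/
def eigenfunctions (n : ℕ) : Set (PhaseSpace n → ℂ) :=
  {F | Measurable F ∧ (∃ C : ℝ, ∀ ω, ‖F ω‖ ≤ C) ∧ ∃ k m : ℤ, ∀ t ω,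
    F (billiardFlow n t ω) =
      Complex.exp (t * frequency k m (phaseHalfChord ω) * Complex.I) * F ω}

theorem one_mem_eigenfunctions : 1 ∈ eigenfunctions n :=
  ⟨measurable_one, ⟨1, fun ω => by simp⟩, 0, 0, fun t ω => by simp [frequency]⟩

theorem mul_mem_eigenfunctions {F G : PhaseSpace n → ℂ} (hF : F ∈ eigenfunctions n)
    (hG : G ∈ eigenfunctions n) : F * G ∈ eigenfunctions n := by
  obtain ⟨hFm, ⟨C, hC⟩, k, m, hF⟩ := hF
  obtain ⟨hGm, ⟨D, hD⟩, k', m', hG⟩ := hG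
  refine ⟨hFm.mul hGm, ⟨C * D, fun ω => ?_⟩, k + k', m + m', fun t ω => ?_⟩
  · rw [Pi.mul_apply, norm_mul]
    exact mul_le_mul (hC ω) (hD ω) (norm_nonneg _) ((norm_nonneg _).trans (hC ω))
  · have hfreq : frequency (k + k') (m + m') (phaseHalfChord ω) =
        frequency k m (phaseHalfChord ω) + frequency k' m' (phaseHalfChord ω) := by
      simp only [frequency]
      push_cast
      ring
    rw [Pi.mul_apply, Pi.mul_apply, hF, hG, hfreq, Complex.ofReal_add, mul_add, add_mul,
      Complex.exp_add]
    ring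

theorem star_mem_eigenfunctions {F : PhaseSpace n → ℂ} (hF : F ∈ eigenfunctions n) :
    star F ∈ eigenfunctions n := by
  obtain ⟨hFm, ⟨C, hC⟩, k, m, hF⟩ := hF
  refine ⟨Complex.continuous_conj.measurable.comp hFm, ⟨C, fun ω => ?_⟩, -k, -m, fun t ω => ?_⟩
  · rw [Pi.star_apply, norm_star]
    exact hC ω
  · have hfreq : frequency (-k) (-m) (phaseHalfChord ω) = -frequency k m (phaseHalfChord ω) := by
      simp only [frequency]
      push_cast
      ring
    simp only [Pi.star_apply, hF, star_mul', RCLike.star_def, ← Complex.exp_conj, map_mul,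
      Complex.conj_ofReal, Complex.conj_I, hfreq]
    congr 2
    push_cast
    ring

theorem phaseActionAngle_mem_eigenfunctions (i : Option (Option (Fin n))) :
    phaseActionAngle i ∈ eigenfunctions n := by
  refine ⟨measurable_from_quotient.2 (measurable_actionAngle i), ⟨1, fun ω => ?_⟩, ?_⟩
  · induction ω using Quotient.inductionOn with
    | h p => exact norm_actionAngle_le i p
  · obtain ⟨k, m, h⟩ := exists_actionAngle_evolve i
    refine ⟨k, m, fun t ω => ?_⟩
    induction ω using Quotient.inductionOn with
    | h p => exact h t p

/-- Action and angle variables generate the σ-algebra of the phase space, up to null sets. -/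
theorem exists_eq_comp_phaseActionAngle (hn : 2 ≤ n) {u : PhaseSpace n → ℂ} (hu : Measurable u) :
    ∃ G : (Option (Option (Fin n)) → ℂ) → ℂ, Measurable G ∧
      u =ᵐ[liouville n] fun ω => G fun i => phaseActionAngle i ω := by
  -- On this set of full measure, the states inside the ball that do not lie on a diameter, the
  -- variables are injective.
  let D : Set (PosVel n) := {p | ‖(p.1 : E n)‖ < 1} ∩ {p | halfChord p < 1}
  have hD : MeasurableSet D := ((isOpen_lt (by fun_prop) continuous_const).inter
    (isOpen_lt continuous_halfChord continuous_const)).measurableSet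
  have : StandardBorelSpace (closedBall (0 : E n) 1) := measurableSet_closedBall.standardBorel
  have : StandardBorelSpace (sphere (0 : E n) 1) := isClosed_sphere.measurableSet.standardBorel
  have : StandardBorelSpace D := hD.standardBorel
  let e : D → Option (Option (Fin n)) → ℂ := fun p i => actionAngle i p
  have he : Measurable e := measurable_pi_lambda _ fun i =>
    (measurable_actionAngle i).comp measurable_subtype_coe
  have hinj : Function.Injective e := by
    rintro ⟨p, hp⟩ ⟨q, hq⟩ hpq
    have hi := fun i => congrFun hpq i
    exact Subtype.ext (eq_of_phases_eq hp.1 hq.1 hp.2 (Complex.ofReal_injective (hi none))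
      (hi (some none)) fun j => hi (some (some j)))
  -- By the Lusin–Souslin theorem an injective measurable map between these standard Borel spaces is
  -- a measurable embedding, so `u` factors through it by a measurable `G`.
  obtain ⟨G, hG, hGe⟩ := (he.measurableEmbedding hinj).exists_measurable_extend
    ((hu.comp measurable_mk).comp measurable_subtype_coe) fun _ => inferInstance
  refine ⟨G, hG, ae_liouville_of_ae_stateMeasure (measurableSet_eq_fun hu (hG.comp
    (measurable_pi_lambda _ fun i => (phaseActionAngle_mem_eigenfunctions i).1))) ?_⟩
  filter_upwards [ae_norm_lt_one, ae_halfChord_mem_Ioo hn] with p h1 h2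
  exact (congrFun hGe ⟨p, h1, h2.2⟩).symm

/-- An eigenfunction is invariant, or its translates converge weakly to zero. -/
theorem eigenfunction_invariant_or_tendsto (hn : 2 ≤ n) {F : PhaseSpace n → ℂ}
    (hF : F ∈ eigenfunctions n) : (∀ t ω, F (billiardFlow n t ω) = F ω) ∨
      ∀ φ : PhaseSpace n → ℂ, MemLp φ 2 (liouville n) →
        Tendsto (fun t : ℝ => ∫ ω, conj (φ ω) * F (billiardFlow n t ω) ∂liouville n) atTop
          (𝓝 0) := by
  have := (isProbabilityPreservingFlow_billiardFlow hn).isProbabilityMeasure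
  obtain ⟨hFm, ⟨C, hC⟩, k, m, hF⟩ := hF
  by_cases hkm : k = 0 ∧ m = 0
  · left
    intro t ω
    simp [hF, hkm.1, hkm.2, frequency]
  · right
    intro φ hφ
    have hint : Integrable (fun ω => conj (φ ω) * F ω) (liouville n) := by
      have hφi : Integrable (fun ω => conj (φ ω)) (liouville n) :=
        (LinearIsometryEquiv.integrable_comp_iff Complex.conjLIE).2 (hφ.integrable one_le_two)
      exact hφi.mul_bdd hFm.aestronglyMeasurable (Eventually.of_forall hC)
    have h := tendsto_integral_exp_mul_of_map_absolutelyContinuous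
      ((measurable_frequency k m).comp measurable_phaseHalfChord) (liouville_map_frequency hn hkm)
      hint
    refine h.congr fun t => integral_congr_ae (Eventually.of_forall fun ω => ?_)
    simp only [hF, Function.comp_apply]
    ring

end Law

/-! ### Conclusion: the eigenfunctions as spanning family. -/

theorem exhibitsKeplerianShear_billiardFlow {n : ℕ} (hn : 2 ≤ n) :
    ExhibitsKeplerianShear (liouville n) (billiardFlow n) := by
  have hflow := isProbabilityPreservingFlow_billiardFlow hn
  have := hflow.isProbabilityMeasure
  refine exhibitsKeplerianShear_of_dense hflow (eigenfunctions n) (fun F hF => hF.1)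
    (fun F hF => ?_) (fun f => ?_) fun F hF => eigenfunction_invariant_or_tendsto hn hF
  · obtain ⟨hFm, ⟨C, hC⟩, -⟩ := hF
    exact MemLp.of_bound hFm.aestronglyMeasurable C (Eventually.of_forall hC)
  · refine mem_closure_span_of_generating phaseActionAngle
      (fun i => (phaseActionAngle_mem_eigenfunctions i).1) (fun i ω => ?_)
      (fun u hu => exists_eq_comp_phaseActionAngle hn hu) _ one_mem_eigenfunctions
      (fun F hF G hG => mul_mem_eigenfunctions hF hG) (fun F hF => star_mem_eigenfunctions hF)
      phaseActionAngle_mem_eigenfunctions f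
    induction ω using Quotient.inductionOn with
    | h p => exact norm_actionAngle_le i p

end KeplerianShear

/-- The billiard flow in the unit ball of `ℝⁿ`, `n ≥ 2`, with the Liouville measure, exhibits
Keplerian shear. -/
theorem mainTheorem7 (n : ℕ) (hn : 2 ≤ n) :
    KeplerianShear.ExhibitsKeplerianShear (KeplerianShear.liouville n)
      (KeplerianShear.billiardFlow n) :=
  KeplerianShear.exhibitsKeplerianShear_billiardFlow hn
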